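/- Let $M$ be a connected, complete smooth Riemannian manifold without boundary, with metric $\langle\cdot,\cdot\rangle$, $m=\dim M$, and let integrals and "a.e." refer to the Riemannian volume measure. Let $p\in(1,+\infty)$, $p'=\frac{p}{p-1}$, $\lambda>0$ and $k>0$. Let $A$ assign to each $x\in M$, $s\in\mathbb R$, $\xi\in T_xM$ a vector $A(x,s,\xi)\in T_xM$, such that in every local chart $\psi:U\subseteq M\to\mathbb R^m$ the local representation $\tilde A:\psi(U)\times\mathbb R\times\mathbb R^m\to\mathbb R^m$ of $A$ satisfies the Carathéodory conditions: $\tilde A(y,\cdot,\cdot)$ is continuous for a.e. $y\in\psi(U)$, and $\tilde A(\cdot,s,v)$ is measurable for every $(s,v)$. Suppose that $Lu=\operatorname{div}A(x,u,\nabla u)$ is weakly-$p$-coercive with coercivity constant $k$, that is, $$\langle A(x,s,\xi),\xi\rangle\ge 0\quad\text{and}\quad |A(x,s,\xi)|\le k\,\langle A(x,s,\xi),\xi\rangle^{\frac{p-1}{p}}\qquad\text{for all }x\in M,\ s\in\mathbb R,\ \xi\in T_xM.$$ Let $u\in W^{1,p}_{\mathrm{loc}}(M)$ be a weak solution of $Lu=\lambda|u|^{p-2}u$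 on $M$, that is, $$-\int_M\langle A(x,u,\nabla u),\nabla\varphi\rangle=\int_M\lambda|u|^{p-2}u\,\varphi\qquad\text{for all }\varphi\in W^{1,p}_{\mathrm{loc}}(M)\text{ with compact support}.$$ If for some $x_0\in M$, some $q\in(p-1,+\infty)$ and some $$C<\frac{p\,(q-p+1)^{1/p'}}{(p-1)^{1/p'}}\,\frac{\lambda^{1/p}}{k}$$ one has $$\int_{B_R(x_0)}|u|^q\le e^{CR}\qquad\text{for all sufficiently large }R,$$ then $u=0$ a.e. on $M$. -/

import Mathlib

open Set Filter Topology MeasureTheory Bundle Manifold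
open scoped ENNReal ContDiff InnerProductSpace

noncomputable section

namespace RiemannianLiouville

variable {m : ℕ} {M : Type*} [TopologicalSpace M] [ChartedSpace (EuclideanSpace ℝ (Fin m)) M]

/-- The tangent vector of `M` at `e.symm y` whose components in the coordinates of the chart `e`
are the entries of `v`, that is `∑ i, v i • ∂/∂yⁱ`. -/
def coordVector (e : OpenPartialHomeomorph M (EuclideanSpace ℝ (Fin m)))
    (y v : EuclideanSpace ℝ (Fin m)) : TangentSpace (𝓡 m) (e.symm y) :=
  mfderiv (𝓡 m) (𝓡 m) e.symm y v

/-- The components, in the coordinates of the chart `e`, of a tangent vector at `e.symm y`. -/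
def chartComponents (e : OpenPartialHomeomorph M (EuclideanSpace ℝ (Fin m)))
    (y : EuclideanSpace ℝ (Fin m)) (ξ : TangentSpace (𝓡 m) (e.symm y)) :
    EuclideanSpace ℝ (Fin m) :=
  mfderiv (𝓡 m) (𝓡 m) e (e.symm y) ξ

/-- The local representation of `A` in the chart `e`. -/
def localRep (A : (x : M) → ℝ → TangentSpace (𝓡 m) x → TangentSpace (𝓡 m) x)
    (e : OpenPartialHomeomorph M (EuclideanSpace ℝ (Fin m)))
    (y : EuclideanSpace ℝ (Fin m)) (s : ℝ) (v : EuclideanSpace ℝ (Fin m)) :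
    EuclideanSpace ℝ (Fin m) :=
  chartComponents e y (A (e.symm y) s (coordVector e y v))

/-- The Carathéodory conditions, in every chart of the smooth structure. Measurability is with
respect to the Lebesgue σ-algebra. -/
structure IsCaratheodory
    (A : (x : M) → ℝ → TangentSpace (𝓡 m) x → TangentSpace (𝓡 m) x) : Prop where
  continuous : ∀ e ∈ IsManifold.maximalAtlas (𝓡 m) ∞ M,
    ∀ᵐ y ∂(volume.restrict e.target),
      Continuous fun z : ℝ × EuclideanSpace ℝ (Fin m) => localRep A e y z.1 z.2
  measurable : ∀ e ∈ IsManifold.maximalAtlas (𝓡 m) ∞ M,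
    ∀ (s : ℝ) (v : EuclideanSpace ℝ (Fin m)),
      AEMeasurable (fun y => localRep A e y s v) (volume.restrict e.target)

variable [RiemannianBundle (fun x : M => TangentSpace (𝓡 m) x)]

/-- The matrix `g_ij = ⟨∂/∂yⁱ, ∂/∂yʲ⟩` of the Riemannian metric in the chart `e`. -/
def gramMatrix (e : OpenPartialHomeomorph M (EuclideanSpace ℝ (Fin m)))
    (y : EuclideanSpace ℝ (Fin m)) : Matrix (Fin m) (Fin m) ℝ :=
  Matrix.of fun i j =>
    ⟪coordVector e y (EuclideanSpace.single i 1), coordVector e y (EuclideanSpace.single j 1)⟫_ℝ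

/-- `L u = div A(x, u, ∇u)` is weakly-`p`-coercive with coercivity constant `k`. -/
structure IsWeaklyCoercive (p k : ℝ)
    (A : (x : M) → ℝ → TangentSpace (𝓡 m) x → TangentSpace (𝓡 m) x) : Prop where
  caratheodory : IsCaratheodory A
  inner_nonneg : ∀ (x : M) (s : ℝ) (ξ : TangentSpace (𝓡 m) x), 0 ≤ ⟪A x s ξ, ξ⟫_ℝ
  norm_le : ∀ (x : M) (s : ℝ) (ξ : TangentSpace (𝓡 m) x),
    ‖A x s ξ‖ ≤ k * ⟪A x s ξ, ξ⟫_ℝ ^ ((p - 1) / p)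

/-- The vector field `X` is a weak gradient of `u`: in every chart, the components
`⟨X, ∂/∂yⁱ⟩` are the weak partial derivatives of `u`. -/
structure IsWeakGradient (u : M → ℝ) (X : (x : M) → TangentSpace (𝓡 m) x) : Prop where
  locallyIntegrable : ∀ e ∈ IsManifold.maximalAtlas (𝓡 m) ∞ M,
    LocallyIntegrableOn (fun y => u (e.symm y)) e.target volume
  locallyIntegrable_grad : ∀ e ∈ IsManifold.maximalAtlas (𝓡 m) ∞ M,
    ∀ v : EuclideanSpace ℝ (Fin m),
      LocallyIntegrableOn (fun y => ⟪X (e.symm y), coordVector e y v⟫_ℝ) e.target volume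
  integral_eq : ∀ e ∈ IsManifold.maximalAtlas (𝓡 m) ∞ M,
    ∀ (v : EuclideanSpace ℝ (Fin m)) (ζ : EuclideanSpace ℝ (Fin m) → ℝ),
      ContDiff ℝ ∞ ζ → HasCompactSupport ζ → tsupport ζ ⊆ e.target →
        ∫ y in e.target, u (e.symm y) * fderiv ℝ ζ y v =
          -∫ y in e.target, ⟪X (e.symm y), coordVector e y v⟫_ℝ * ζ y

variable [MeasurableSpace M]

/-- The Riemannian volume of the domain of the chart `e`: the measure with density
`√(det g_ij)` with respect to Lebesgue measure in the coordinates of `e`. -/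
def chartVolume (e : OpenPartialHomeomorph M (EuclideanSpace ℝ (Fin m))) : Measure M :=
  ((volume.restrict e.target).withDensity
    fun y => ENNReal.ofReal √(gramMatrix e y).det).map e.symm

variable (m M) in
/-- The Riemannian volume measure of `M`. The measures `chartVolume e` and `chartVolume e'` agree
on the intersection of the domains of `e` and `e'`, so that the least measure above all of them is
the measure whose restriction to the domain of each chart `e` is `chartVolume e`. -/
def riemannianVolume : Measure M :=
  ⨆ e ∈ IsManifold.maximalAtlas (𝓡 m) ∞ M, chartVolume e

/-- `u` belongs to `W^{1,p}_loc(M)` and its weak gradient is `X`. -/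
structure HasSobolevGradient (p : ℝ) (u : M → ℝ) (X : (x : M) → TangentSpace (𝓡 m) x) :
    Prop where
  isWeakGradient : IsWeakGradient u X
  memLp : ∀ K : Set M, IsCompact K →
    MemLp u (ENNReal.ofReal p) ((riemannianVolume m M).restrict K)
  memLp_grad : ∀ K : Set M, IsCompact K →
    MemLp (fun x => ‖X x‖) (ENNReal.ofReal p) ((riemannianVolume m M).restrict K)

variable (m) in
/-- The space `W^{1,p}_loc(M)`. -/
def MemSobolevLoc (p : ℝ) (u : M → ℝ) : Prop :=
  ∃ X : (x : M) → TangentSpace (𝓡 m) x, HasSobolevGradient p u X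

/-- `u ∈ W^{1,p}_loc(M)` is a weak solution of `div A(x, u, ∇u) = f` on `M`; the test functions
are the compactly supported elements `φ` of `W^{1,p}_loc(M)`, with weak gradient `Y`. -/
def IsWeakSolution (p : ℝ) (A : (x : M) → ℝ → TangentSpace (𝓡 m) x → TangentSpace (𝓡 m) x)
    (f u : M → ℝ) : Prop :=
  ∃ X : (x : M) → TangentSpace (𝓡 m) x, HasSobolevGradient p u X ∧
    ∀ (φ : M → ℝ) (Y : (x : M) → TangentSpace (𝓡 m) x),
      HasSobolevGradient p φ Y → HasCompactSupport φ →
        -∫ x, ⟪A x (u x) (X x), Y x⟫_ℝ ∂(riemannianVolume m M) =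
          ∫ x, f x * φ x ∂(riemannianVolume m M)

end RiemannianLiouville

end

noncomputable section

open scoped Convolution NNReal

namespace RiemannianLiouville

/-! Fix `c` strictly between `max C 0` and the critical constant. Put `r = dist · x₀`, `α = q - p +
1`, `w = e^{-cr/p}`, `ε = e^{-cR/p}`, and test the equation with `h(u) (w - ε)₊^p`, where `h` is a
truncation of `sign(t)|t|^α`. By Hopf–Rinow closed balls are compact, so this test function has
compact support.

Let `a = ⟨A, ∇u⟩`. The equation yields the good term `h'(u) a (w - ε)^p` and a term carrying `∇r`.
Since `|∇r| ≤ 1`, weak coercivity bounds the latter by `k c a^{(p-1)/p} |h(u)| w (w - ε)^{p-1}`, and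
Young's inequality absorbs its `a`-part into the good term. If `σ |h| ≤ |t| h'`, what remains is
`∫_{B_R} |u|^{p-1} |h(u)| ((w - ε)^p - Θ σ^{1-p} w^p) ≤ 0`, with `Θ = (kc)^p / (p λ p'^{p-1})`
(`integrand_lower_bound`, `energy_nonpos`). The truncations have `σ → α` and are dominated by
`|u|^q`, so in the limit the coefficient of `w^p` is `κ = Θ / α^{p-1}` (`energy_limit_nonpos`). The
condition `κ < 1` is exactly the upper bound on `c` (`coercivity_ratio_lt`).

To compare `w` with `w - ε`, use `w^p ≤ (1-s)^{1-p} (w - ε)^p + s^{1-p} ε^p` with `s` so small that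
`κ (1-s)^{1-p} < 1`. The error is a multiple of `ε^p ∫_{B_R} |u|^q ≤ e^{(C-c)R}`, which tends to
zero. Hence `|u|^{p-1} H(u)` has zero integral on every fixed ball, where `H`, the limit of the
`|h|`, is positive off zero (`setIntegral_le_of_energy`, `ae_eq_zero_of_energy`).

The other results justify the test function: the chain and product rules for weak gradients, by
mollification in charts (`HasWeakDerivOn.comp_mul_lipschitz`), Rademacher's theorem for `r`, and the
measurability of `⟨A(x, u, X), Y⟩`. -/

/-! ### Hopf–Rinow: compactness of closed balls. -/

/-- The Hopf–Rinow theorem for length spaces: a complete, locally compact metric space in which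
points can be interpolated with arbitrarily small loss is proper. -/
theorem properSpace_of_approximate_interpolation {α : Type*} [MetricSpace α] [CompleteSpace α]
    [LocallyCompactSpace α]
    (H : ∀ (x y : α) (a b : ℝ), 0 ≤ a → 0 < b → dist x y < a + b →
      ∃ z, dist x z ≤ a ∧ dist z y < b) : ProperSpace α := by
  refine ProperSpace.of_isCompact_closedBall_of_le 0 fun x r₀ _ => ?_
  by_contra hr₀
  set S : Set ℝ := {r | 0 ≤ r ∧ IsCompact (Metric.closedBall x r)} with hS
  have hmono : ∀ r s, s ≤ r → IsCompact (Metric.closedBall x r) →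
      IsCompact (Metric.closedBall x s) := fun r s hsr hr =>
    hr.of_isClosed_subset Metric.isClosed_closedBall (Metric.closedBall_subset_closedBall hsr)
  have hSne : S.Nonempty := ⟨0, le_rfl, by simp⟩
  have hbd : BddAbove S := ⟨r₀, fun r hr => by
    by_contra h
    exact hr₀ (hmono r r₀ (not_le.1 h).le hr.2)⟩
  set R := sSup S with hR
  have hR0 : 0 ≤ R := le_csSup hbd ⟨le_rfl, by simp⟩
  have hlt : ∀ s < R, IsCompact (Metric.closedBall x s) := fun s hs => by
    obtain ⟨r, hr, hsr⟩ := exists_lt_of_lt_csSup hSne hs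
    exact hmono r s hsr.le hr.2
  -- Each point of this ball is within `ε / 2` of the compact ball of radius `max (R - ε / 4) 0`, so
  -- a finite `ε / 2`-net of the latter is an `ε`-net here.
  have hcomp : IsCompact (Metric.closedBall x R) := by
    refine isCompact_iff_totallyBounded_isComplete.2 ⟨?_, Metric.isClosed_closedBall.isComplete⟩
    rw [Metric.totallyBounded_iff]
    intro ε hε
    have hK : IsCompact (Metric.closedBall x (max (R - ε / 4) 0)) := by
      rcases le_or_gt (R - ε / 4) 0 with h | h
      · rw [max_eq_right h]; simp
      · rw [max_eq_left h.le]; exact hlt _ (by linarith)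
    obtain ⟨t, htf, ht⟩ := Metric.totallyBounded_iff.1 hK.totallyBounded (ε / 2) (by linarith)
    refine ⟨t, htf, fun y hy => ?_⟩
    obtain ⟨z, hz1, hz2⟩ := H x y (max (R - ε / 4) 0) (ε / 2) (le_max_right _ _) (by linarith) (by
      have := le_max_left (R - ε / 4) 0
      rw [Metric.mem_closedBall, dist_comm] at hy
      linarith)
    obtain ⟨w, hw, hzw⟩ := mem_iUnion₂.1 (ht (by rwa [Metric.mem_closedBall, dist_comm]))
    refine mem_iUnion₂.2 ⟨w, hw, ?_⟩
    rw [Metric.mem_ball] at hzw ⊢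
    rw [dist_comm] at hz2
    linarith [dist_triangle y z w]
  -- By interpolation the compact `δ`-thickening contains the ball of radius `R + δ / 2`, against
  -- the choice of `R` as a supremum.
  obtain ⟨δ, hδ, hδc⟩ := hcomp.exists_isCompact_cthickening
  have : R + δ / 2 ∈ S := by
    refine ⟨by linarith, hδc.of_isClosed_subset Metric.isClosed_closedBall fun y hy => ?_⟩
    obtain ⟨z, hz1, hz2⟩ := H x y R δ hR0 hδ (by
      rw [Metric.mem_closedBall, dist_comm] at hy; linarith)
    rw [dist_comm] at hz1 hz2
    exact Metric.mem_cthickening_of_dist_le y z δ _ hz1 hz2.le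
  linarith [le_csSup hbd this]

section Riemannian

variable {m : ℕ} {M : Type*} [MetricSpace M] [ChartedSpace (EuclideanSpace ℝ (Fin m)) M]
  [RiemannianBundle (fun x : M => TangentSpace (𝓡 m) x)]

/-- On a Riemannian manifold points can be interpolated with arbitrarily small loss. -/
theorem exists_dist_le_dist_lt [IsRiemannianManifold (𝓡 m) M] (x y : M) (a b : ℝ)
    (ha : 0 ≤ a) (hb : 0 < b) (hxy : dist x y < a + b) : ∃ z, dist x z ≤ a ∧ dist z y < b := by
  rcases le_total (dist x y) a with h | h
  · exact ⟨y, h, by simpa using hb⟩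
  have h1 : riemannianEDist (𝓡 m) x y < ENNReal.ofReal (a + b) := by
    rw [← IsRiemannianManifold.out (I := 𝓡 m) x y, edist_dist]
    exact (ENNReal.ofReal_lt_ofReal_iff (by linarith)).2 hxy
  obtain ⟨γ, h0, h1, hγ, hlen⟩ := exists_lt_of_riemannianEDist_lt h1
  have hcont : ContinuousOn (fun t => dist x (γ t)) (Icc 0 1) :=
    (continuous_const.dist continuous_id).comp_continuousOn hγ.continuousOn
  -- `z` is a point of a curve of length below `a + b` at distance exactly `a` from `x`: the arc
  -- before it has length at least `a`, so the rest is shorter than `b`.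
  obtain ⟨t, ht, hta⟩ := intermediate_value_Icc zero_le_one hcont
    (show a ∈ Icc (dist x (γ 0)) (dist x (γ 1)) by simp [h0, h1, ha, h])
  have hta : dist x (γ t) = a := hta
  refine ⟨γ t, hta.le, ?_⟩
  have e1 : edist x (γ t) ≤ pathELength (𝓡 m) γ 0 t := by
    rw [IsRiemannianManifold.out (I := 𝓡 m)]
    exact riemannianEDist_le_pathELength (hγ.mono (Icc_subset_Icc_right ht.2)) h0 rfl ht.1
  have e2 : edist (γ t) y ≤ pathELength (𝓡 m) γ t 1 := by
    rw [IsRiemannianManifold.out (I := 𝓡 m)]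
    exact riemannianEDist_le_pathELength (hγ.mono (Icc_subset_Icc_left ht.1)) rfl h1 ht.2
  have e3 : edist x (γ t) + edist (γ t) y < ENNReal.ofReal (a + b) := by
    refine (add_le_add e1 e2).trans_lt ?_
    rwa [pathELength_add ht.1 ht.2]
  rw [edist_dist, edist_dist, hta, ← ENNReal.ofReal_add ha dist_nonneg,
    ENNReal.ofReal_lt_ofReal_iff (by linarith)] at e3
  linarith

variable (m M) in
/-- The Hopf–Rinow theorem: a complete Riemannian manifold is proper. -/
theorem properSpace_of_completeSpace [IsRiemannianManifold (𝓡 m) M] [CompleteSpace M] :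
    ProperSpace M := by
  have : LocallyCompactSpace M := Manifold.locallyCompact_of_finiteDimensional (𝓡 m)
  exact properSpace_of_approximate_interpolation (exists_dist_le_dist_lt (m := m))

end Riemannian

/-! ### Coordinate vectors in charts. -/

section Charts

variable {m : ℕ} {M : Type*} [TopologicalSpace M] [ChartedSpace (EuclideanSpace ℝ (Fin m)) M]
  {e : OpenPartialHomeomorph M (EuclideanSpace ℝ (Fin m))}

theorem mdifferentiable_of_mem_maximalAtlas [IsManifold (𝓡 m) ∞ M]
    (he : e ∈ IsManifold.maximalAtlas (𝓡 m) ∞ M) :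
    e.MDifferentiable (𝓡 m) (𝓡 m) :=
  ⟨(contMDiffOn_of_mem_maximalAtlas he).mdifferentiableOn (by simp),
    (contMDiffOn_symm_of_mem_maximalAtlas he).mdifferentiableOn (by simp)⟩

theorem coordVector_zero (y : EuclideanSpace ℝ (Fin m)) : coordVector e y 0 = 0 :=
  map_zero (mfderiv (𝓡 m) (𝓡 m) e.symm y)

theorem coordVector_smul (y : EuclideanSpace ℝ (Fin m)) (t : ℝ) (v : EuclideanSpace ℝ (Fin m)) :
    coordVector e y (t • v) = t • coordVector e y v :=
  map_smul (mfderiv (𝓡 m) (𝓡 m) e.symm y) t v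

theorem coordVector_eq_sum (e : OpenPartialHomeomorph M (EuclideanSpace ℝ (Fin m)))
    (y v : EuclideanSpace ℝ (Fin m)) :
    coordVector e y v = ∑ i, v i • coordVector e y (EuclideanSpace.single i 1) := by
  have h : v = ∑ i, v i • EuclideanSpace.single i (1 : ℝ) := by
    ext j
    simp [Finset.sum_apply, Pi.single_apply]
  conv_lhs => rw [h]
  exact (map_sum (mfderiv (𝓡 m) (𝓡 m) e.symm y) _ _).trans
    (Finset.sum_congr rfl fun i _ => coordVector_smul y (v i) _)

variable [IsManifold (𝓡 m) ∞ M]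

theorem chartComponents_coordVector (he : e ∈ IsManifold.maximalAtlas (𝓡 m) ∞ M)
    {y : EuclideanSpace ℝ (Fin m)} (hy : y ∈ e.target) (v : EuclideanSpace ℝ (Fin m)) :
    chartComponents e y (coordVector e y v) = v :=
  DFunLike.congr_fun ((mdifferentiable_of_mem_maximalAtlas he).comp_symm_deriv hy) v

theorem coordVector_chartComponents (he : e ∈ IsManifold.maximalAtlas (𝓡 m) ∞ M)
    {y : EuclideanSpace ℝ (Fin m)} (hy : y ∈ e.target) (ξ : TangentSpace (𝓡 m) (e.symm y)) :
    coordVector e y (chartComponents e y ξ) = ξ := by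
  have h := (mdifferentiable_of_mem_maximalAtlas he).symm_comp_deriv (e.map_target hy)
  rw [e.right_inv hy] at h
  exact DFunLike.congr_fun h ξ

/-- Continuity is joint in the base point and the components; local bounds on the operator norm of
the coordinate map come from this. -/
theorem continuousOn_coordVector (he : e ∈ IsManifold.maximalAtlas (𝓡 m) ∞ M) :
    ContinuousOn (fun z : EuclideanSpace ℝ (Fin m) × EuclideanSpace ℝ (Fin m) =>
      (TotalSpace.mk (e.symm z.1) (coordVector e z.1 z.2) : TangentBundle (𝓡 m) M))
      (e.target ×ˢ univ) := by
  have h1 := (contMDiffOn_symm_of_mem_maximalAtlas he).continuousOn_tangentMapWithin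
    (by simp) e.open_target.uniqueMDiffOn
  have h2 : Continuous fun z : EuclideanSpace ℝ (Fin m) × EuclideanSpace ℝ (Fin m) =>
      (TotalSpace.mk z.1 z.2 : TangentBundle (𝓡 m) (EuclideanSpace ℝ (Fin m))) :=
    (tangentBundleModelSpaceHomeomorph (𝓡 m)).symm.continuous
  refine (h1.comp h2.continuousOn (fun z hz => hz.1)).congr fun z hz => ?_
  simp only [Function.comp, tangentMapWithin, coordVector]
  rw [mfderivWithin_of_isOpen e.open_target hz.1]

theorem mdifferentiableAt_symm_of_differentiableAt_comp
    (he : e ∈ IsManifold.maximalAtlas (𝓡 m) ∞ M)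
    {f : M → ℝ} {y : EuclideanSpace ℝ (Fin m)} (hy : y ∈ e.target)
    (hf : DifferentiableAt ℝ (fun z => f (e.symm z)) y) :
    MDifferentiableAt (𝓡 m) 𝓘(ℝ, ℝ) f (e.symm y) := by
  have h1 : MDifferentiableAt (𝓡 m) 𝓘(ℝ, ℝ) (fun z => f (e.symm z)) (e (e.symm y)) := by
    rw [e.right_inv hy]; exact hf.mdifferentiableAt
  have h2 := h1.comp (e.symm y)
    ((mdifferentiable_of_mem_maximalAtlas he).mdifferentiableAt (e.map_target hy))
  refine h2.congr_of_eventuallyEq ?_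
  filter_upwards [e.open_source.mem_nhds (e.map_target hy)] with x hx
  simp [e.left_inv hx]

theorem mfderiv_coordVector (he : e ∈ IsManifold.maximalAtlas (𝓡 m) ∞ M)
    {f : M → ℝ} {y : EuclideanSpace ℝ (Fin m)} (hy : y ∈ e.target)
    (hf : DifferentiableAt ℝ (fun z => f (e.symm z)) y) (v : EuclideanSpace ℝ (Fin m)) :
    mfderiv (𝓡 m) 𝓘(ℝ, ℝ) f (e.symm y) (coordVector e y v) =
      fderiv ℝ (fun z => f (e.symm z)) y v := by
  have h := mfderiv_comp y (mdifferentiableAt_symm_of_differentiableAt_comp he hy hf)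
    ((mdifferentiable_of_mem_maximalAtlas he).mdifferentiableAt_symm hy)
  rw [← mfderiv_eq_fderiv]
  exact (DFunLike.congr_fun h v).symm

section Metric

variable [RiemannianBundle (fun x : M => TangentSpace (𝓡 m) x)]

variable (m M) in
theorem isContinuousRiemannianBundle_tangentSpace
    [IsContMDiffRiemannianBundle (𝓡 m) ∞ (EuclideanSpace ℝ (Fin m))
      (fun x : M => TangentSpace (𝓡 m) x)] :
    IsContinuousRiemannianBundle (EuclideanSpace ℝ (Fin m))
      (fun x : M => TangentSpace (𝓡 m) x) := by
  obtain ⟨g, hg, h⟩ := IsContMDiffRiemannianBundle.exists_contMDiff (IB := 𝓡 m) (n := ∞)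
    (F := EuclideanSpace ℝ (Fin m)) (E := fun x : M => TangentSpace (𝓡 m) x)
  exact ⟨g, hg.continuous, h⟩

theorem continuousOn_inner_coordVector
    [IsContMDiffRiemannianBundle (𝓡 m) ∞ (EuclideanSpace ℝ (Fin m))
      (fun x : M => TangentSpace (𝓡 m) x)]
    (he : e ∈ IsManifold.maximalAtlas (𝓡 m) ∞ M) (v w : EuclideanSpace ℝ (Fin m)) :
    ContinuousOn (fun y => ⟪coordVector e y v, coordVector e y w⟫_ℝ) e.target := by
  have := isContinuousRiemannianBundle_tangentSpace m M
  have h (v : EuclideanSpace ℝ (Fin m)) : ContinuousOn (fun y : EuclideanSpace ℝ (Fin m) =>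
      (TotalSpace.mk (e.symm y) (coordVector e y v) : TangentBundle (𝓡 m) M)) e.target :=
    (continuousOn_coordVector he).comp (f := fun y => (y, v)) (by fun_prop)
      fun y hy => ⟨hy, mem_univ _⟩
  exact (h v).inner_bundle (h w)

theorem continuousOn_norm_coordVector
    [IsContMDiffRiemannianBundle (𝓡 m) ∞ (EuclideanSpace ℝ (Fin m))
      (fun x : M => TangentSpace (𝓡 m) x)]
    (he : e ∈ IsManifold.maximalAtlas (𝓡 m) ∞ M) :
    ContinuousOn (fun z : EuclideanSpace ℝ (Fin m) × EuclideanSpace ℝ (Fin m) =>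
      ‖coordVector e z.1 z.2‖) (e.target ×ˢ univ) := by
  have := isContinuousRiemannianBundle_tangentSpace m M
  have := (continuousOn_coordVector he).inner_bundle (continuousOn_coordVector he)
  refine (Real.continuous_sqrt.comp_continuousOn this).congr fun z _ => ?_
  exact norm_eq_sqrt_real_inner _

end Metric

end Charts

/-! ### Riemannian distance compared with coordinates. -/

section Distance

variable {m : ℕ} {M : Type*} [MetricSpace M] [ChartedSpace (EuclideanSpace ℝ (Fin m)) M]
  [IsManifold (𝓡 m) ∞ M] [RiemannianBundle (fun x : M => TangentSpace (𝓡 m) x)]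
  {e : OpenPartialHomeomorph M (EuclideanSpace ℝ (Fin m))}

/-- The image of a coordinate segment is a competitor for the distance, and its velocity is
`coordVector e (y + t • w) w`. -/
theorem dist_symm_le [IsRiemannianManifold (𝓡 m) M]
    (he : e ∈ IsManifold.maximalAtlas (𝓡 m) ∞ M)
    {y w : EuclideanSpace ℝ (Fin m)} {C : ℝ} (hC : 0 ≤ C)
    (hmem : ∀ t ∈ Icc (0 : ℝ) 1, y + t • w ∈ e.target)
    (hbd : ∀ t ∈ Icc (0 : ℝ) 1, ‖coordVector e (y + t • w) w‖ ≤ C) :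
    dist (e.symm y) (e.symm (y + w)) ≤ C := by
  set γ : ℝ → M := fun t => e.symm (y + t • w) with hγ
  have hline : ContDiff ℝ ∞ (fun t : ℝ => y + t • w) := by fun_prop
  have hsm : ContMDiffOn 𝓘(ℝ, ℝ) (𝓡 m) 1 γ (Icc 0 1) :=
    ((contMDiffOn_symm_of_mem_maximalAtlas he).of_le (by simp)).comp
      ((hline.of_le (by simp)).contMDiff.contMDiffOn) hmem
  have hle := riemannianEDist_le_pathELength hsm (x := e.symm y) (y := e.symm (y + w))
    (by simp [hγ]) (by simp [hγ]) zero_le_one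
  rw [← IsRiemannianManifold.out (I := 𝓡 m), pathELength_eq_lintegral_mfderiv_Icc] at hle
  have hb : ∫⁻ t in Icc (0 : ℝ) 1, ‖mfderiv 𝓘(ℝ, ℝ) (𝓡 m) γ t 1‖ₑ
      ≤ ∫⁻ _ in Icc (0 : ℝ) 1, ENNReal.ofReal C := by
    refine setLIntegral_mono' measurableSet_Icc fun t ht => ?_
    have h1 : HasFDerivAt (fun t : ℝ => y + t • w) (ContinuousLinearMap.toSpanSingleton ℝ w) t := by
      have := ((hasDerivAt_id t).smul_const w).const_add y
      simpa [ContinuousLinearMap.smulRight_one_eq_toSpanSingleton] using this.hasFDerivAt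
    have h2 := ((mdifferentiable_of_mem_maximalAtlas he).mdifferentiableAt_symm
      (hmem t ht)).hasMFDerivAt.comp t h1.hasMFDerivAt
    have h3 : mfderiv 𝓘(ℝ, ℝ) (𝓡 m) γ t 1 = coordVector e (y + t • w) w := by
      have := h2.mfderiv
      refine (DFunLike.congr_fun this (1 : ℝ)).trans ?_
      have h4 : (ContinuousLinearMap.toSpanSingleton ℝ w) (1 : ℝ) = w := by simp
      change mfderiv (𝓡 m) (𝓡 m) e.symm (y + t • w)
        ((ContinuousLinearMap.toSpanSingleton ℝ w) (1 : ℝ)) = _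
      rw [h4]; rfl
    rw [h3, ← ofReal_norm]
    exact ENNReal.ofReal_le_ofReal (hbd t ht)
  have := hle.trans hb
  rw [edist_dist] at this
  simpa [ENNReal.ofReal_le_ofReal_iff hC] using this

variable [IsContMDiffRiemannianBundle (𝓡 m) ∞ (EuclideanSpace ℝ (Fin m))
  (fun x : M => TangentSpace (𝓡 m) x)]

/-- The norm is continuous at `(y, 0)` and vanishes there, so it is below `1` on an `ε`-ball.
Homogeneity in `w` turns this into a linear bound with constant `2 / ε`. -/
theorem exists_norm_coordVector_le (he : e ∈ IsManifold.maximalAtlas (𝓡 m) ∞ M)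
    {y : EuclideanSpace ℝ (Fin m)} (hy : y ∈ e.target) :
    ∃ ε > 0, ∃ C ≥ 0, ∀ z ∈ Metric.ball y ε, z ∈ e.target ∧
      ∀ w, ‖coordVector e z w‖ ≤ C * ‖w‖ := by
  have hopen : IsOpen (e.target ×ˢ (univ : Set (EuclideanSpace ℝ (Fin m)))) :=
    e.open_target.prod isOpen_univ
  have hc := (continuousOn_norm_coordVector he).continuousAt
    (hopen.mem_nhds (show (y, (0 : EuclideanSpace ℝ (Fin m))) ∈ _ from ⟨hy, mem_univ _⟩))
  have h1 : ∀ᶠ z : EuclideanSpace ℝ (Fin m) × EuclideanSpace ℝ (Fin m) in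
      𝓝 (y, (0 : EuclideanSpace ℝ (Fin m))), ‖coordVector e z.1 z.2‖ < 1 := by
    refine hc.eventually_lt continuousAt_const ?_
    simp [coordVector_zero]
  have h2 := h1.and (hopen.mem_nhds (show (y, (0 : EuclideanSpace ℝ (Fin m))) ∈ _ from
    ⟨hy, mem_univ _⟩))
  obtain ⟨ε, hε, h⟩ := Metric.eventually_nhds_iff_ball.1 h2
  refine ⟨ε, hε, 2 / ε, by positivity, fun z hz => ?_⟩
  have hprod : ∀ w : EuclideanSpace ℝ (Fin m), ‖w‖ < ε →
      (z, w) ∈ Metric.ball (y, (0 : EuclideanSpace ℝ (Fin m))) ε := fun w hw => by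
    rw [← ball_prod_same]; exact ⟨hz, by simpa using hw⟩
  refine ⟨(h (z, 0) (hprod 0 (by simpa using hε))).2.1, fun w => ?_⟩
  rcases eq_or_ne w 0 with rfl | hw
  · simp [coordVector_zero]
  have hw0 : 0 < ‖w‖ := norm_pos_iff.2 hw
  have h3 := (h (z, (ε / (2 * ‖w‖)) • w) (hprod _ (by
    rw [norm_smul, Real.norm_of_nonneg (by positivity)]
    field_simp; norm_num))).1
  simp only [coordVector_smul] at h3
  rw [norm_smul, Real.norm_of_nonneg (by positivity)] at h3
  have : ‖coordVector e z w‖ = (2 / ε * ‖w‖) * (ε / (2 * ‖w‖) * ‖coordVector e z w‖) := by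
    field_simp
  rw [this]
  exact mul_le_of_le_one_right (by positivity) h3.le

variable [IsRiemannianManifold (𝓡 m) M]

theorem locallyLipschitzOn_comp_symm (he : e ∈ IsManifold.maximalAtlas (𝓡 m) ∞ M)
    {f : M → ℝ} (hf : LipschitzWith 1 f) :
    LocallyLipschitzOn e.target (fun y => f (e.symm y)) := by
  intro y hy
  obtain ⟨ε, hε, C, hC, h⟩ := exists_norm_coordVector_le he hy
  refine ⟨C.toNNReal, Metric.ball y ε, mem_nhdsWithin_of_mem_nhds (Metric.ball_mem_nhds y hε), ?_⟩
  refine LipschitzOnWith.of_dist_le_mul fun z hz w hw => ?_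
  have hseg : ∀ t ∈ Icc (0 : ℝ) 1, z + t • (w - z) ∈ Metric.ball y ε := fun t ht => by
    have := (convex_ball y ε).add_smul_sub_mem hz hw ht
    exact this
  have := dist_symm_le he (y := z) (w := w - z) (C := C * ‖w - z‖) (by positivity)
    (fun t ht => (h _ (hseg t ht)).1) (fun t ht => (h _ (hseg t ht)).2 _)
  rw [Real.coe_toNNReal C hC, dist_comm z w, dist_eq_norm w z]
  refine (hf.dist_le_mul _ _).trans ?_
  simpa using this

/-- Along a short segment in direction `v`, distances grow at rate at most `‖coordVector e y v‖ +
δ`, by continuity of the norm; then `δ → 0`. -/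
theorem abs_fderiv_comp_symm_le (he : e ∈ IsManifold.maximalAtlas (𝓡 m) ∞ M)
    {f : M → ℝ} (hf : LipschitzWith 1 f) {y : EuclideanSpace ℝ (Fin m)} (hy : y ∈ e.target)
    (hd : DifferentiableAt ℝ (fun z => f (e.symm z)) y) (v : EuclideanSpace ℝ (Fin m)) :
    |fderiv ℝ (fun z => f (e.symm z)) y v| ≤ ‖coordVector e y v‖ := by
  refine le_of_forall_pos_le_add fun δ hδ => ?_
  have hopen : IsOpen (e.target ×ˢ (univ : Set (EuclideanSpace ℝ (Fin m)))) :=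
    e.open_target.prod isOpen_univ
  have hmem : (y, v) ∈ e.target ×ˢ (univ : Set (EuclideanSpace ℝ (Fin m))) := ⟨hy, mem_univ _⟩
  have hc := (continuousOn_norm_coordVector he).continuousAt (hopen.mem_nhds hmem)
  have h1 : ∀ᶠ z : EuclideanSpace ℝ (Fin m) × EuclideanSpace ℝ (Fin m) in
      𝓝 (y, v), ‖coordVector e z.1 z.2‖ < ‖coordVector e y v‖ + δ :=
    hc.eventually_lt continuousAt_const (by simpa using hδ)
  have h2 := h1.and (hopen.mem_nhds hmem)
  have hline : Tendsto (fun t : ℝ => (y + t • v, v)) (𝓝 0) (𝓝 (y, v)) := by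
    have : Continuous fun t : ℝ => (y + t • v, v) := by fun_prop
    simpa using this.tendsto 0
  obtain ⟨ε, hε, h⟩ := Metric.eventually_nhds_iff_ball.1 (hline.eventually h2)
  have hderiv : HasDerivAt (fun t : ℝ => f (e.symm (y + t • v)))
      (fderiv ℝ (fun z => f (e.symm z)) y v) 0 := by
    have := hd.hasFDerivAt.hasLineDerivAt v
    exact this
  rw [← Real.norm_eq_abs]
  refine hderiv.le_of_lip' (by positivity) ?_
  filter_upwards [Metric.ball_mem_nhds (0 : ℝ) hε] with t ht
  have hsub : ∀ s ∈ Icc (0 : ℝ) 1, s * t ∈ Metric.ball (0 : ℝ) ε := fun s hs => by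
    rw [mem_ball_zero_iff, norm_mul, Real.norm_of_nonneg hs.1]
    rw [mem_ball_zero_iff] at ht
    exact (mul_le_of_le_one_left (norm_nonneg _) hs.2).trans_lt ht
  have := dist_symm_le he (y := y) (w := t • v) (C := (‖coordVector e y v‖ + δ) * ‖t‖)
    (by positivity)
    (fun s hs => by rw [smul_smul]; exact (h _ (hsub s hs)).2.1)
    (fun s hs => by
      rw [smul_smul, coordVector_smul, norm_smul, mul_comm]
      gcongr
      exact (h _ (hsub s hs)).1.le)
  rw [← dist_eq_norm, dist_comm]
  simp only [zero_smul, add_zero, sub_zero]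
  refine (hf.dist_le_mul _ _).trans ?_
  simpa using this

end Distance

/-! ### The gradient of a 1-Lipschitz function. -/

section Gradient

variable {m : ℕ} {M : Type*}

instance finiteDimensional_tangentSpace [TopologicalSpace M]
    [ChartedSpace (EuclideanSpace ℝ (Fin m)) M] (x : M) :
    FiniteDimensional ℝ (TangentSpace (𝓡 m) x) :=
  inferInstanceAs (FiniteDimensional ℝ (EuclideanSpace ℝ (Fin m)))

variable (m) in
/-- The Riemannian gradient of a function, with value zero where it is not differentiable. -/
def grad [TopologicalSpace M] [ChartedSpace (EuclideanSpace ℝ (Fin m)) M]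
    [RiemannianBundle (fun x : M => TangentSpace (𝓡 m) x)]
    (f : M → ℝ) (x : M) : TangentSpace (𝓡 m) x :=
  haveI : CompleteSpace (TangentSpace (𝓡 m) x) := FiniteDimensional.complete ℝ _
  (InnerProductSpace.toDual ℝ (TangentSpace (𝓡 m) x)).symm (mfderiv (𝓡 m) 𝓘(ℝ, ℝ) f x)

theorem inner_grad [TopologicalSpace M] [ChartedSpace (EuclideanSpace ℝ (Fin m)) M]
    [RiemannianBundle (fun x : M => TangentSpace (𝓡 m) x)]
    (f : M → ℝ) (x : M) (v : TangentSpace (𝓡 m) x) :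
    ⟪grad m f x, v⟫_ℝ = mfderiv (𝓡 m) 𝓘(ℝ, ℝ) f x v := by
  have : CompleteSpace (TangentSpace (𝓡 m) x) := FiniteDimensional.complete ℝ _
  exact InnerProductSpace.toDual_symm_apply

variable [MetricSpace M] [ChartedSpace (EuclideanSpace ℝ (Fin m)) M]
  [IsManifold (𝓡 m) ∞ M] [RiemannianBundle (fun x : M => TangentSpace (𝓡 m) x)]

theorem inner_grad_coordVector {e : OpenPartialHomeomorph M (EuclideanSpace ℝ (Fin m))}
    (he : e ∈ IsManifold.maximalAtlas (𝓡 m) ∞ M)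
    {f : M → ℝ} {y : EuclideanSpace ℝ (Fin m)} (hy : y ∈ e.target)
    (hf : DifferentiableAt ℝ (fun z => f (e.symm z)) y) (v : EuclideanSpace ℝ (Fin m)) :
    ⟪grad m f (e.symm y), coordVector e y v⟫_ℝ = fderiv ℝ (fun z => f (e.symm z)) y v := by
  rw [inner_grad, mfderiv_coordVector he hy hf]

/-- The derivative bound in the direction of the gradient itself reads `‖∇f‖² ≤ ‖∇f‖`. -/
theorem norm_grad_le_one [IsContMDiffRiemannianBundle (𝓡 m) ∞ (EuclideanSpace ℝ (Fin m))
    (fun x : M => TangentSpace (𝓡 m) x)] [IsRiemannianManifold (𝓡 m) M]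
    {f : M → ℝ} (hf : LipschitzWith 1 f) (x : M) : ‖grad m f x‖ ≤ 1 := by
  by_cases hx : MDifferentiableAt (𝓡 m) 𝓘(ℝ, ℝ) f x
  swap
  · have h0 : ‖grad m f x‖ ^ 2 = 0 := by
      rw [← real_inner_self_eq_norm_sq, inner_grad, mfderiv_zero_of_not_mdifferentiableAt hx]
      rfl
    rw [pow_eq_zero_iff two_ne_zero] at h0
    rw [h0]; exact zero_le_one
  -- Working at points of the form `e.symm y` avoids transporting tangent vectors along `x = e.symm
  -- (e x)`.
  suffices H : ∀ e ∈ IsManifold.maximalAtlas (𝓡 m) ∞ M, ∀ y ∈ e.target,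
      MDifferentiableAt (𝓡 m) 𝓘(ℝ, ℝ) f (e.symm y) → ‖grad m f (e.symm y)‖ ≤ 1 by
    have h := H (chartAt (EuclideanSpace ℝ (Fin m)) x) (IsManifold.chart_mem_maximalAtlas x)
      _ (mem_chart_target _ x)
    rw [(chartAt (EuclideanSpace ℝ (Fin m)) x).left_inv (mem_chart_source _ x)] at h
    exact h hx
  intro e he y hy hx
  have hd : DifferentiableAt ℝ (fun z => f (e.symm z)) y :=
    (hx.comp y ((mdifferentiable_of_mem_maximalAtlas he).mdifferentiableAt_symm
      hy)).differentiableAt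
  have h1 := abs_fderiv_comp_symm_le he hf hy hd (chartComponents e y (grad m f (e.symm y)))
  rw [← inner_grad_coordVector he hy hd, coordVector_chartComponents he hy,
    real_inner_self_eq_norm_sq, abs_of_nonneg (by positivity)] at h1
  nlinarith [norm_nonneg (grad m f (e.symm y))]

end Gradient

/-! ### Convergence of mollifications in `L¹` and of integrals. -/

/-- Scheffé's lemma for nonnegative real functions. -/
theorem tendsto_integral_abs_sub_of_integral_eq {α : Type*} [MeasurableSpace α] {μ : Measure α}
    {F : ℕ → α → ℝ} {f : α → ℝ} (hF : ∀ n, Integrable (F n) μ) (hf : Integrable f μ)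
    (hF0 : ∀ n x, 0 ≤ F n x) (hf0 : ∀ x, 0 ≤ f x) (hint : ∀ n, ∫ x, F n x ∂μ = ∫ x, f x ∂μ)
    (hlim : ∀ᵐ x ∂μ, Tendsto (fun n => F n x) atTop (𝓝 (f x))) :
    Tendsto (fun n => ∫ x, |F n x - f x| ∂μ) atTop (𝓝 0) := by
  have hpos : ∀ n, Integrable (fun x => max (f x - F n x) 0) μ := fun n => (hf.sub (hF n)).pos_part
  -- In `|a - b| = (a - b) + 2 (b - a)₊` the first part integrates to zero, and the second is
  -- dominated by `f`.
  have key : ∀ n, ∫ x, |F n x - f x| ∂μ = 2 * ∫ x, max (f x - F n x) 0 ∂μ := fun n => by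
    have h1 : ∀ x, |F n x - f x| = (F n x - f x) + 2 * max (f x - F n x) 0 := fun x => by
      rcases le_total (f x) (F n x) with h | h
      · rw [abs_of_nonneg (by linarith), max_eq_right (by linarith)]; ring
      · rw [abs_of_nonpos (by linarith), max_eq_left (by linarith)]; ring
    have hsub : Integrable (fun x => F n x - f x) μ := (hF n).sub hf
    simp_rw [h1]
    rw [integral_add hsub ((hpos n).const_mul 2), integral_sub (hF n) hf, hint,
      integral_const_mul]
    ring
  simp_rw [key]
  have h2 : Tendsto (fun n => ∫ x, max (f x - F n x) 0 ∂μ) atTop (𝓝 (∫ _, (0 : ℝ) ∂μ)) := by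
    refine tendsto_integral_of_dominated_convergence f (fun n => (hpos n).aestronglyMeasurable) hf
      (fun n => Eventually.of_forall fun x => ?_) ?_
    · rw [Real.norm_of_nonneg (le_max_right _ _)]
      exact max_le (by linarith [hF0 n x]) (hf0 x)
    · filter_upwards [hlim] with x hx
      have := (tendsto_const_nhds (x := f x)).sub hx
      simpa using this.max (tendsto_const_nhds (x := (0 : ℝ)))
  simpa using h2.const_mul 2

section Mollification

/-- Bump functions at the origin with supports shrinking to it. -/
def shrinkingBump (E : Type*) [NormedAddCommGroup E] (n : ℕ) : ContDiffBump (0 : E) where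
  rIn := 1 / (n + 1)
  rOut := 2 / (n + 1)
  rIn_pos := by positivity
  rIn_lt_rOut := by gcongr; norm_num

theorem tendsto_rOut_shrinkingBump {E : Type*} [NormedAddCommGroup E] :
    Tendsto (fun n => (shrinkingBump E n).rOut) atTop (𝓝 0) := by
  have := (tendsto_one_div_add_atTop_nhds_zero_nat (𝕜 := ℝ)).const_mul 2
  simpa [shrinkingBump, div_eq_mul_inv] using this

variable {E : Type*} [NormedAddCommGroup E] [NormedSpace ℝ E] [FiniteDimensional ℝ E]
  [MeasurableSpace E] [BorelSpace E] (μ : Measure E) [μ.IsAddHaarMeasure]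

/-- The mollification of `f` at scale `n`. -/
def mollify (f : E → ℝ) (n : ℕ) : E → ℝ :=
  (shrinkingBump E n).normed μ ⋆[ContinuousLinearMap.lsmul ℝ ℝ, μ] f

theorem mollify_apply (f : E → ℝ) (n : ℕ) (x : E) :
    mollify μ f n x = ∫ t, f t * (shrinkingBump E n).normed μ (x - t) ∂μ := by
  rw [mollify, convolution_eq_swap]
  simp [mul_comm]

theorem integrable_normed_shrinkingBump (n : ℕ) :
    Integrable ((shrinkingBump E n).normed μ) μ :=
  (shrinkingBump E n).continuous_normed.integrable_of_hasCompactSupport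
    (shrinkingBump E n).hasCompactSupport_normed

theorem integrable_mollify {f : E → ℝ} (hf : Integrable f μ) (n : ℕ) :
    Integrable (mollify μ f n) μ :=
  (integrable_normed_shrinkingBump μ n).integrable_convolution _ hf

theorem integral_mollify {f : E → ℝ} (hf : Integrable f μ) (n : ℕ) :
    ∫ x, mollify μ f n x ∂μ = ∫ x, f x ∂μ := by
  rw [mollify, integral_convolution _ (integrable_normed_shrinkingBump μ n) hf,
    ContDiffBump.integral_normed]
  simp

/-- The fixed ratio `rOut = 2 * rIn` is what differentiation of integrals along shrinking bumps
requires; hence `K = 2`. -/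
theorem ae_tendsto_mollify {f : E → ℝ} (hf : Integrable f μ) :
    ∀ᵐ x ∂μ, Tendsto (fun n => mollify μ f n x) atTop (𝓝 (f x)) :=
  ContDiffBump.ae_convolution_tendsto_right_of_locallyIntegrable (K := 2)
    tendsto_rOut_shrinkingBump (Eventually.of_forall fun n => by simp [shrinkingBump]; rfl)
    hf.locallyIntegrable

theorem contDiff_mollify {f : E → ℝ} (hf : Integrable f μ) (n : ℕ) :
    ContDiff ℝ ∞ (mollify μ f n) :=
  (shrinkingBump E n).hasCompactSupport_normed.contDiff_convolution_left _
    (shrinkingBump E n).contDiff_normed hf.locallyIntegrable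

theorem integrable_mul_normed_shrinkingBump {f : E → ℝ} (hf : Integrable f μ) (n : ℕ) (x : E) :
    Integrable (fun t => f t * (shrinkingBump E n).normed μ (x - t)) μ := by
  obtain ⟨B, hB⟩ := (shrinkingBump E n).continuous_normed (μ := μ)
    |>.bounded_above_of_compact_support (shrinkingBump E n).hasCompactSupport_normed
  refine hf.mul_bdd (c := B) ?_ (Eventually.of_forall fun t => hB _)
  exact ((shrinkingBump E n).continuous_normed.comp
    (continuous_const.sub continuous_id)).aestronglyMeasurable

/-- Mollification preserves positivity and the integral and converges a.e., so Scheffé's lemma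
applies to the positive and the negative part separately. -/
theorem tendsto_integral_abs_mollify_sub {f : E → ℝ} (hf : Integrable f μ) :
    Tendsto (fun n => ∫ x, |mollify μ f n x - f x| ∂μ) atTop (𝓝 0) := by
  have hnn : ∀ g : E → ℝ, Integrable g μ → (∀ x, 0 ≤ g x) →
      Tendsto (fun n => ∫ x, |mollify μ g n x - g x| ∂μ) atTop (𝓝 0) := fun g hg hg0 => by
    refine tendsto_integral_abs_sub_of_integral_eq (integrable_mollify μ hg) hg (fun n x => ?_) hg0
      (integral_mollify μ hg) (ae_tendsto_mollify μ hg)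
    rw [mollify_apply]
    exact integral_nonneg fun t => mul_nonneg (hg0 t) ((shrinkingBump E n).nonneg_normed _)
  have h1 := hnn _ hf.pos_part fun x => le_max_right _ _
  have h2 := hnn _ hf.neg_part fun x => le_max_right _ _
  have h3 := h1.add h2
  rw [add_zero] at h3
  refine squeeze_zero (fun n => integral_nonneg fun x => abs_nonneg _) (fun n => ?_) h3
  have i1 : Integrable (fun x => |mollify μ (fun t => max (f t) 0) n x - max (f x) 0|) μ :=
    ((integrable_mollify μ hf.pos_part n).sub hf.pos_part).abs
  have i2 : Integrable (fun x => |mollify μ (fun t => max (-f t) 0) n x - max (-f x) 0|) μ :=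
    ((integrable_mollify μ hf.neg_part n).sub hf.neg_part).abs
  rw [← integral_add i1 i2]
  refine integral_mono ((integrable_mollify μ hf n).sub hf).abs (i1.add i2) fun x => ?_
  have hsplit : ∀ t, f t = max (f t) 0 - max (-f t) 0 := fun t => by
    rcases le_total 0 (f t) with h | h
    · rw [max_eq_left h, max_eq_right (by linarith)]; ring
    · rw [max_eq_right h, max_eq_left (by linarith)]; ring
  have hm : mollify μ f n x =
      mollify μ (fun t => max (f t) 0) n x - mollify μ (fun t => max (-f t) 0) n x := by
    rw [mollify_apply, mollify_apply, mollify_apply,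
      ← integral_sub (integrable_mul_normed_shrinkingBump μ hf.pos_part n x)
        (integrable_mul_normed_shrinkingBump μ hf.neg_part n x)]
    refine integral_congr_ae (Eventually.of_forall fun t => ?_)
    simp only
    rw [← sub_mul, ← hsplit]
  beta_reduce
  rw [hm]
  conv_lhs => rw [hsplit x]
  rw [show ∀ a b c d : ℝ, a - b - (c - d) = (a - c) - (b - d) by intros; ring]
  exact abs_sub _ _

theorem fderiv_mollify_apply {f : E → ℝ} (hf : Integrable f μ) (n : ℕ) (x v : E) :
    fderiv ℝ (mollify μ f n) x v =
      ∫ t, f t * fderiv ℝ ((shrinkingBump E n).normed μ) (x - t) v ∂μ := by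
  set ρ := (shrinkingBump E n).normed μ with hρ
  have hc : HasCompactSupport ρ := (shrinkingBump E n).hasCompactSupport_normed
  have hs : ContDiff ℝ 1 ρ := (shrinkingBump E n).contDiff_normed
  have h := hc.hasFDerivAt_convolution_left (ContinuousLinearMap.lsmul ℝ ℝ) hs
    hf.locallyIntegrable x
  rw [mollify, h.fderiv, convolution_eq_swap, ContinuousLinearMap.integral_apply]
  · refine integral_congr_ae (Eventually.of_forall fun t => ?_)
    simp [ContinuousLinearMap.precompL_apply, mul_comm]
  · have hex := (hc.fderiv ℝ).convolutionExists_left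
      ((ContinuousLinearMap.lsmul ℝ ℝ : ℝ →L[ℝ] ℝ →L[ℝ] ℝ).precompL E)
      (hs.continuous_fderiv one_ne_zero) hf.locallyIntegrable x
    exact hex.integrable_swap

end Mollification

section Limits

variable {α : Type*} [MeasurableSpace α] {μ : Measure α}

/-- This serves the terms where `h(u)` is not differentiated. The error is at most `L B ‖uₙ - U‖₁`;
integrability of `b` allows `h 0 ≠ 0`. -/
theorem tendsto_integral_lipschitz_comp_mul {U : α → ℝ} {u : ℕ → α → ℝ} {h : ℝ → ℝ} {L : ℝ≥0}
    (hh : LipschitzWith L h) (hU : Integrable U μ) (hu : ∀ n, Integrable (u n) μ)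
    (hlim : Tendsto (fun n => ∫ x, |u n x - U x| ∂μ) atTop (𝓝 0))
    {b : α → ℝ} {B : ℝ} (hb : Integrable b μ) (hB : ∀ x, ‖b x‖ ≤ B) :
    Tendsto (fun n => ∫ x, h (u n x) * b x ∂μ) atTop (𝓝 (∫ x, h (U x) * b x ∂μ)) := by
  have hint : ∀ w : α → ℝ, Integrable w μ → Integrable (fun x => h (w x) * b x) μ := fun w hw => by
    have h1 : Integrable (fun x => |h 0| * ‖b x‖ + L * |w x| * B) μ :=
      (hb.norm.const_mul _).add ((hw.abs.const_mul _).mul_const _)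
    refine h1.mono' ((hh.continuous.comp_aestronglyMeasurable hw.aestronglyMeasurable).mul
      hb.aestronglyMeasurable) (Eventually.of_forall fun x => ?_)
    have h2 : |h (w x) - h 0| ≤ L * |w x| := by
      simpa [Real.dist_eq] using hh.dist_le_mul (w x) 0
    have h3 : |h (w x)| ≤ |h 0| + L * |w x| := by
      have := abs_sub_abs_le_abs_sub (h (w x)) (h 0); linarith
    rw [norm_mul, Real.norm_eq_abs (h (w x))]
    calc |h (w x)| * ‖b x‖ ≤ (|h 0| + L * |w x|) * ‖b x‖ := by gcongr
      _ = |h 0| * ‖b x‖ + L * |w x| * ‖b x‖ := by ring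
      _ ≤ _ := by gcongr; exact hB x
  rw [tendsto_iff_dist_tendsto_zero]
  have h0 := hlim.const_mul (L * B)
  rw [mul_zero] at h0
  refine squeeze_zero (fun n => dist_nonneg) (fun n => ?_) h0
  rw [dist_eq_norm, ← integral_sub (hint _ (hu n)) (hint _ hU), ← integral_const_mul]
  refine norm_integral_le_of_norm_le (((hu n).sub hU).abs.const_mul _)
    (Eventually.of_forall fun x => ?_)
  rw [← sub_mul, norm_mul]
  have h2 : ‖h (u n x) - h (U x)‖ ≤ L * |u n x - U x| := by
    simpa [Real.dist_eq] using hh.dist_le_mul (u n x) (U x)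
  calc ‖h (u n x) - h (U x)‖ * ‖b x‖ ≤ (L * |u n x - U x|) * B := by
        gcongr; exact hB x
    _ = L * B * |u n x - U x| := by ring

/-- This serves the term `h'(u) ∂u`: the first factor is bounded and converges only a.e., while the
second converges in `L¹`. -/
theorem tendsto_integral_bounded_comp_mul_mul {U V : α → ℝ} {u g : ℕ → α → ℝ} {k : ℝ → ℝ} {L : ℝ}
    (hk : Continuous k) (hL : ∀ t, ‖k t‖ ≤ L) (hu : ∀ n, Integrable (u n) μ)
    (hV : Integrable V μ) (hg : ∀ n, Integrable (g n) μ)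
    (hlim : ∀ᵐ x ∂μ, Tendsto (fun n => u n x) atTop (𝓝 (U x)))
    (hlimg : Tendsto (fun n => ∫ x, |g n x - V x| ∂μ) atTop (𝓝 0))
    {b : α → ℝ} {B : ℝ} (hb : AEStronglyMeasurable b μ) (hB : ∀ x, ‖b x‖ ≤ B) :
    Tendsto (fun n => ∫ x, k (u n x) * g n x * b x ∂μ) atTop
      (𝓝 (∫ x, k (U x) * V x * b x ∂μ)) := by
  have hL0 : 0 ≤ L := (norm_nonneg _).trans (hL 0)
  have hint : ∀ w f : α → ℝ, Integrable w μ → Integrable f μ →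
      Integrable (fun x => k (w x) * f x * b x) μ := fun w f hw hf => by
    refine Integrable.mul_bdd (c := B) ?_ hb (Eventually.of_forall hB)
    exact hf.bdd_mul (c := L) (hk.comp_aestronglyMeasurable hw.aestronglyMeasurable)
      (Eventually.of_forall fun x => hL _)
  have h1 : Tendsto (fun n => ∫ x, k (u n x) * V x * b x ∂μ) atTop
      (𝓝 (∫ x, k (U x) * V x * b x ∂μ)) := by
    refine tendsto_integral_of_dominated_convergence (fun x => L * |V x| * B)
      (fun n => (hint _ _ (hu n) hV).aestronglyMeasurable) ((hV.abs.const_mul _).mul_const _)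
      (fun n => Eventually.of_forall fun x => ?_) ?_
    · rw [norm_mul, norm_mul]
      gcongr
      · exact hL _
      · exact le_of_eq (Real.norm_eq_abs _)
      · exact hB x
    · filter_upwards [hlim] with x hx
      exact (((hk.tendsto _).comp hx).mul_const _).mul_const _
  have h2 : Tendsto (fun n => ∫ x, k (u n x) * g n x * b x ∂μ - ∫ x, k (u n x) * V x * b x ∂μ)
      atTop (𝓝 0) := by
    have h0 := hlimg.const_mul (L * B)
    rw [mul_zero] at h0
    refine squeeze_zero_norm (fun n => ?_) h0
    rw [← integral_sub (hint _ _ (hu n) (hg n)) (hint _ _ (hu n) hV), ← integral_const_mul]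
    refine norm_integral_le_of_norm_le (((hg n).sub hV).abs.const_mul _)
      (Eventually.of_forall fun x => ?_)
    rw [← sub_mul, ← mul_sub, norm_mul, norm_mul]
    calc ‖k (u n x)‖ * ‖g n x - V x‖ * ‖b x‖ ≤ L * |g n x - V x| * B := by
          gcongr
          · exact hL _
          · exact le_of_eq (Real.norm_eq_abs _)
          · exact hB x
      _ = L * B * |g n x - V x| := by ring
  simpa using h2.add h1

end Limits

/-! ### Weak derivatives in a vector space. -/

section WeakDerivative

variable {E : Type*} [NormedAddCommGroup E] [NormedSpace ℝ E] [FiniteDimensional ℝ E]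
  [MeasurableSpace E] [BorelSpace E] {μ : Measure E} [μ.IsAddHaarMeasure]

/-- `g` is the weak derivative of `w` in the direction `v` on `Ω`. -/
def HasWeakDerivOn (μ : Measure E) (Ω : Set E) (v : E) (w g : E → ℝ) : Prop :=
  ∀ ζ : E → ℝ, ContDiff ℝ ∞ ζ → HasCompactSupport ζ → tsupport ζ ⊆ Ω →
    ∫ y in Ω, w y * fderiv ℝ ζ y v ∂μ = -∫ y in Ω, g y * ζ y ∂μ

/-- The reflected kernel `t ↦ ρ (x - t)` is itself a test function, supported in `K`; the sign from
the reflection cancels the one from integration by parts. -/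
theorem HasWeakDerivOn.fderiv_mollify {Ω : Set E} {v : E} {w g : E → ℝ}
    (hwg : HasWeakDerivOn μ Ω v w g) {K : Set E} (hK : MeasurableSet K) (hKΩ : K ⊆ Ω)
    (hΩ : MeasurableSet Ω) (hw : IntegrableOn w K μ)
    {n : ℕ} {x : E} (hx : Metric.closedBall x (shrinkingBump E n).rOut ⊆ K) :
    fderiv ℝ (mollify μ (K.indicator w) n) x v = mollify μ (K.indicator g) n x := by
  set ρ := (shrinkingBump E n).normed μ with hρ
  have hw' : Integrable (K.indicator w) μ := (integrable_indicator_iff hK).2 hw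
  rw [fderiv_mollify_apply μ hw', mollify_apply, ← hρ]
  set ζ : E → ℝ := fun t => ρ (x - t) with hζ
  have hρs : ContDiff ℝ ∞ ρ := (shrinkingBump E n).contDiff_normed
  have hζs : ContDiff ℝ ∞ ζ := hρs.comp (contDiff_const.sub contDiff_id)
  have hts : tsupport ζ ⊆ Metric.closedBall x (shrinkingBump E n).rOut := by
    refine closure_minimal (fun t ht => ?_) Metric.isClosed_closedBall
    have h1 : x - t ∈ Function.support ρ := ht
    rw [hρ, ContDiffBump.support_normed_eq, mem_ball_zero_iff] at h1
    rw [Metric.mem_closedBall, dist_comm, dist_eq_norm]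
    exact h1.le
  have hζc : HasCompactSupport ζ :=
    (isCompact_closedBall x _).of_isClosed_subset (isClosed_tsupport _) hts
  have h := hwg ζ hζs hζc (hts.trans (hx.trans hKΩ))
  have hfd : ∀ t, fderiv ℝ ζ t v = -fderiv ℝ ρ (x - t) v := fun t => by
    have h1 : HasFDerivAt ρ (fderiv ℝ ρ (x - t)) (x - t) :=
      (hρs.differentiable (by simp) _).hasFDerivAt
    have h2 := h1.comp t ((hasFDerivAt_const x t).sub (hasFDerivAt_id t))
    rw [show fderiv ℝ ζ t = _ from h2.fderiv]
    simp
  have hzero : ∀ t, t ∉ K → ζ t = 0 := fun t ht =>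
    image_eq_zero_of_notMem_tsupport fun h => ht (hx (hts h))
  have hzero' : ∀ t, t ∉ K → fderiv ℝ ζ t v = 0 := fun t ht => by
    rw [image_eq_zero_of_notMem_tsupport (f := fderiv ℝ ζ) fun h =>
      ht (hx (hts (tsupport_fderiv_subset ℝ h)))]
    rfl
  have e1 : ∫ t, K.indicator w t * fderiv ℝ ρ (x - t) v ∂μ =
      -∫ y in Ω, w y * fderiv ℝ ζ y v ∂μ := by
    rw [← integral_indicator hΩ, ← integral_neg]
    refine integral_congr_ae (Eventually.of_forall fun t => ?_)
    by_cases ht : t ∈ K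
    · simp [ht, hKΩ ht, hfd]
    · by_cases ht' : t ∈ Ω
      · simp [ht, ht', hzero' t ht]
      · simp [ht, ht']
  have e2 : ∫ t, K.indicator g t * ρ (x - t) ∂μ = ∫ y in Ω, g y * ζ y ∂μ := by
    rw [← integral_indicator hΩ]
    refine integral_congr_ae (Eventually.of_forall fun t => ?_)
    by_cases ht : t ∈ K
    · simp [ht, hKΩ ht, hζ]
    · by_cases ht' : t ∈ Ω
      · simp [ht, ht', hzero t ht]
      · simp [ht, ht']
  rw [e1, e2, h, neg_neg]

/-- The chain rule and the product rule for a smooth function. -/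
theorem integral_comp_mul_lipschitz_mul_fderiv {w : E → ℝ} (hw : ContDiff ℝ 1 w)
    {h : ℝ → ℝ} (hh : ContDiff ℝ 1 h) {η : E → ℝ} {D : ℝ≥0} (hη : LipschitzWith D η)
    {ζ : E → ℝ} (hζ : ContDiff ℝ 1 ζ) (hζc : HasCompactSupport ζ) (v : E) :
    ∫ x, h (w x) * (η x * fderiv ℝ ζ x v) ∂μ =
      -(∫ x, deriv h (w x) * fderiv ℝ w x v * (η x * ζ x) ∂μ +
        ∫ x, h (w x) * (lineDeriv ℝ η x v * ζ x) ∂μ) := by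
  have hG : ContDiff ℝ 1 fun x => h (w x) * ζ x := (hh.comp hw).mul hζ
  have hGc : HasCompactSupport fun x => h (w x) * ζ x := hζc.mul_left
  obtain ⟨D', hD'⟩ := hG.lipschitzWith_of_hasCompactSupport hGc one_ne_zero
  have key := hη.integral_lineDeriv_mul_eq (μ := μ) hD' hGc v
  have hfd : ∀ x, lineDeriv ℝ (fun x => h (w x) * ζ x) x (-v) =
      -(deriv h (w x) * fderiv ℝ w x v * ζ x + h (w x) * fderiv ℝ ζ x v) := fun x => by
    rw [(hG.differentiable one_ne_zero x).lineDeriv_eq_fderiv, map_neg]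
    have h1 : HasFDerivAt (fun x => h (w x)) (deriv h (w x) • fderiv ℝ w x) x :=
      (hh.differentiable one_ne_zero _).hasDerivAt.comp_hasFDerivAt x
        (hw.differentiable one_ne_zero x).hasFDerivAt
    have h2 := h1.mul (hζ.differentiable one_ne_zero x).hasFDerivAt
    rw [show fderiv ℝ (fun x => h (w x) * ζ x) x = _ from h2.fderiv]
    simp; ring
  have c1 : Continuous fun x => fderiv ℝ ζ x v :=
    (hζ.continuous_fderiv one_ne_zero).clm_apply continuous_const
  have c2 : Continuous fun x => fderiv ℝ w x v :=
    (hw.continuous_fderiv one_ne_zero).clm_apply continuous_const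
  have c3 : Continuous fun x => deriv h (w x) :=
    (hh.continuous_deriv le_rfl).comp hw.continuous
  have i1 : Integrable (fun x => h (w x) * (η x * fderiv ℝ ζ x v)) μ := by
    refine Continuous.integrable_of_hasCompactSupport
      ((hh.continuous.comp hw.continuous).mul (hη.continuous.mul c1)) ?_
    exact ((hζc.fderiv_apply ℝ v).mul_left).mul_left
  have i2 : Integrable (fun x => deriv h (w x) * fderiv ℝ w x v * (η x * ζ x)) μ := by
    refine Continuous.integrable_of_hasCompactSupport
      ((c3.mul c2).mul (hη.continuous.mul hζ.continuous)) ?_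
    exact (hζc.mul_left).mul_left
  have e1 : ∫ x, h (w x) * (lineDeriv ℝ η x v * ζ x) ∂μ =
      ∫ x, lineDeriv ℝ η x v * (h (w x) * ζ x) ∂μ := by
    congr 1; ext x; ring
  rw [e1, key]
  simp_rw [hfd]
  rw [← sub_eq_zero, sub_neg_eq_add, ← integral_add i2, ← integral_add i1]
  · rw [integral_eq_zero_of_ae]
    exact Eventually.of_forall fun x => by simp; ring
  · refine (i2.add (i2.add i1).neg).congr (Eventually.of_forall fun x => ?_)
    simp; ring
  · refine (i2.add i1).neg.congr (Eventually.of_forall fun x => ?_)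
    simp; ring

/-- Cut `w` and `g` off outside a compact neighbourhood of the support of `ζ`, mollify, use the
identity for smooth functions, and pass to the limit. The bound on `h'` makes `L¹` convergence
sufficient. -/
theorem HasWeakDerivOn.comp_mul_lipschitz {Ω : Set E} (hΩ : IsOpen Ω) {v : E} {w g : E → ℝ}
    (hw : LocallyIntegrableOn w Ω μ) (hg : LocallyIntegrableOn g Ω μ)
    (hwg : HasWeakDerivOn μ Ω v w g) {h : ℝ → ℝ} (hh : ContDiff ℝ 1 h) {L : ℝ≥0}
    (hL : ∀ t, ‖deriv h t‖ ≤ L) {η : E → ℝ} {D : ℝ≥0} (hη : LipschitzWith D η) :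
    HasWeakDerivOn μ Ω v (fun y => h (w y) * η y)
      (fun y => deriv h (w y) * g y * η y + h (w y) * lineDeriv ℝ η y v) := by
  intro ζ hζ hζc hζΩ
  have hζ1 : ContDiff ℝ 1 ζ := hζ.of_le (by simp)
  obtain ⟨δ, hδ, hδΩ⟩ := hζc.isCompact.exists_cthickening_subset_open hΩ hζΩ
  set K := Metric.cthickening δ (tsupport ζ) with hKdef
  have hKc : IsCompact K := hζc.isCompact.cthickening
  have hKm : MeasurableSet K := hKc.measurableSet
  set U := K.indicator w with hUdef
  set V := K.indicator g with hVdef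
  have hU : Integrable U μ := (integrable_indicator_iff hKm).2 (hw.integrableOn_compact_subset
    hδΩ hKc)
  have hV : Integrable V μ := (integrable_indicator_iff hKm).2 (hg.integrableOn_compact_subset
    hδΩ hKc)
  have hhL : LipschitzWith L h := lipschitzWith_of_nnnorm_deriv_le
    (hh.differentiable one_ne_zero) hL
  have hsK : ∀ x, x ∉ K → ζ x = 0 := fun x hx => image_eq_zero_of_notMem_tsupport fun h =>
    hx (Metric.self_subset_cthickening _ h)
  have hsK' : ∀ x, x ∉ K → fderiv ℝ ζ x v = 0 := fun x hx => by
    rw [image_eq_zero_of_notMem_tsupport (f := fderiv ℝ ζ) fun h =>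
      hx (Metric.self_subset_cthickening _ (tsupport_fderiv_subset ℝ h))]
    rfl
  have c1 : Continuous fun x => η x * fderiv ℝ ζ x v := hη.continuous.mul
    ((hζ1.continuous_fderiv one_ne_zero).clm_apply continuous_const)
  have s1 : HasCompactSupport fun x => η x * fderiv ℝ ζ x v := (hζc.fderiv_apply ℝ v).mul_left
  obtain ⟨B1, hB1⟩ := c1.bounded_above_of_compact_support s1
  have c2 : Continuous fun x => η x * ζ x := hη.continuous.mul hζ.continuous
  have s2 : HasCompactSupport fun x => η x * ζ x := hζc.mul_left
  obtain ⟨B2, hB2⟩ := c2.bounded_above_of_compact_support s2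
  obtain ⟨B3, hB3⟩ := hζ.continuous.bounded_above_of_compact_support hζc
  have hld : AEStronglyMeasurable (fun x => lineDeriv ℝ η x v) μ :=
    (hη.locallyIntegrable_lineDeriv v).aestronglyMeasurable
  have hldb : ∀ x, ‖lineDeriv ℝ η x v‖ ≤ D * ‖v‖ := fun x =>
    norm_lineDeriv_le_of_lipschitz ℝ hη
  have i3 : Integrable (fun x => lineDeriv ℝ η x v * ζ x) μ :=
    (hζ.continuous.integrable_of_hasCompactSupport hζc).bdd_mul hld (Eventually.of_forall hldb)
  have t1 := tendsto_integral_lipschitz_comp_mul hhL hU (integrable_mollify μ hU)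
    (tendsto_integral_abs_mollify_sub μ hU) (c1.integrable_of_hasCompactSupport s1) hB1
  have t3 := tendsto_integral_lipschitz_comp_mul hhL hU (integrable_mollify μ hU)
    (tendsto_integral_abs_mollify_sub μ hU) i3 (B := D * ‖v‖ * B3) (fun x => by
      rw [norm_mul]; gcongr
      · exact hldb x
      · exact hB3 x)
  have t2 := tendsto_integral_bounded_comp_mul_mul (hh.continuous_deriv le_rfl) hL
    (integrable_mollify μ hU) hV (integrable_mollify μ hV) (ae_tendsto_mollify μ hU)
    (tendsto_integral_abs_mollify_sub μ hV) c2.aestronglyMeasurable hB2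
  -- At scales below `δ`, mollification at a point of the support of `ζ` sees only `K`, where
  -- differentiating the mollified `w` gives the mollified `g`.
  have hev : ∀ᶠ n in atTop, ∫ x, h (mollify μ U n x) * (η x * fderiv ℝ ζ x v) ∂μ =
      -(∫ x, deriv h (mollify μ U n x) * mollify μ V n x * (η x * ζ x) ∂μ +
        ∫ x, h (mollify μ U n x) * (lineDeriv ℝ η x v * ζ x) ∂μ) := by
    filter_upwards [(tendsto_rOut_shrinkingBump (E := E)).eventually (gt_mem_nhds hδ)] with n hn
    rw [integral_comp_mul_lipschitz_mul_fderiv ((contDiff_mollify μ hU n).of_le (by simp)) hh hη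
      hζ1 hζc v]
    congr 2
    refine integral_congr_ae (Eventually.of_forall fun x => ?_)
    by_cases hx : x ∈ tsupport ζ
    · simp only
      rw [hwg.fderiv_mollify hKm hδΩ hΩ.measurableSet ((integrable_indicator_iff hKm).1 hU)]
      exact (Metric.closedBall_subset_closedBall hn.le).trans
        (Metric.closedBall_subset_cthickening hx δ)
    · simp [image_eq_zero_of_notMem_tsupport hx]
  have hlim := tendsto_nhds_unique (t1.congr' hev) (t2.add t3).neg
  have e1 : ∫ y in Ω, h (w y) * η y * fderiv ℝ ζ y v ∂μ =
      ∫ x, h (U x) * (η x * fderiv ℝ ζ x v) ∂μ := by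
    rw [← integral_indicator hΩ.measurableSet]
    refine integral_congr_ae (Eventually.of_forall fun x => ?_)
    by_cases hx : x ∈ K
    · simp [hδΩ hx, hUdef, hx, mul_assoc]
    · by_cases hx' : x ∈ Ω <;> simp [hx', hsK' x hx]
  have i2 : Integrable (fun x => deriv h (U x) * V x * (η x * ζ x)) μ := by
    refine Integrable.mul_bdd (c := B2) ?_ c2.aestronglyMeasurable (Eventually.of_forall hB2)
    exact hV.bdd_mul (c := L) ((hh.continuous_deriv le_rfl).comp_aestronglyMeasurable
      hU.aestronglyMeasurable) (Eventually.of_forall fun x => hL _)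
  have i4 : Integrable (fun x => h (U x) * (lineDeriv ℝ η x v * ζ x)) μ := by
    have hdecomp : ∀ x, h (U x) * (lineDeriv ℝ η x v * ζ x) =
        (h (U x) - h 0) * (lineDeriv ℝ η x v * ζ x) + h 0 * (lineDeriv ℝ η x v * ζ x) :=
      fun x => by ring
    simp_rw [hdecomp]
    refine Integrable.add ?_ (i3.const_mul _)
    refine Integrable.mul_bdd (c := D * ‖v‖ * B3) ?_ i3.aestronglyMeasurable
      (Eventually.of_forall fun x => ?_)
    · refine (hU.norm.const_mul (L : ℝ)).mono'
        ((hhL.continuous.comp_aestronglyMeasurable hU.aestronglyMeasurable).sub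
          aestronglyMeasurable_const) (Eventually.of_forall fun x => ?_)
      simpa [Real.dist_eq] using hhL.dist_le_mul (U x) 0
    · rw [norm_mul]; gcongr
      · exact hldb x
      · exact hB3 x
  rw [e1, hlim, ← integral_add i2 i4, ← integral_indicator hΩ.measurableSet]
  congr 1
  refine integral_congr_ae (Eventually.of_forall fun x => ?_)
  by_cases hx : x ∈ K
  · simp [hδΩ hx, hUdef, hVdef, hx]; ring
  · by_cases hx' : x ∈ Ω <;> simp [hx', hsK x hx]

end WeakDerivative

/-! ### Weak gradients on the manifold. -/

/-- Near a compact subset of an open set, a locally Lipschitz function agrees with a Lipschitz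
one. -/
theorem exists_lipschitzWith_eqOn_nhds {E : Type*} [MetricSpace E] [LocallyCompactSpace E]
    {Ω K : Set E} (hΩ : IsOpen Ω) (hK : IsCompact K) (hKΩ : K ⊆ Ω) {f : E → ℝ}
    (hf : LocallyLipschitzOn Ω f) :
    ∃ (f' : E → ℝ) (D : ℝ≥0) (O : Set E), LipschitzWith D f' ∧ IsOpen O ∧ K ⊆ O ∧ O ⊆ Ω ∧
      EqOn f f' O := by
  obtain ⟨K', hK', hKK', hK'Ω⟩ := exists_compact_between hK hΩ hKΩ
  obtain ⟨D, hD⟩ := (hf.mono hK'Ω).exists_lipschitzOnWith_of_compact hK'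
  obtain ⟨f', hf', heq⟩ := hD.extend_real
  exact ⟨f', D, interior K', hf', isOpen_interior, hKK', interior_subset.trans hK'Ω,
    heq.mono interior_subset⟩

section

variable {m : ℕ} {M : Type*} [MetricSpace M] [ChartedSpace (EuclideanSpace ℝ (Fin m)) M]
  [IsManifold (𝓡 m) ∞ M] [RiemannianBundle (fun x : M => TangentSpace (𝓡 m) x)]
  [IsContMDiffRiemannianBundle (𝓡 m) ∞ (EuclideanSpace ℝ (Fin m))
    (fun x : M => TangentSpace (𝓡 m) x)] [IsRiemannianManifold (𝓡 m) M]

/-- The product rule in a chart needs a globally Lipschitz factor, so `G(r)` is replaced by one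
agreeing with it near `K`; Rademacher's theorem then identifies its derivative a.e. -/
theorem exists_lipschitzWith_comp_symm {e : OpenPartialHomeomorph M (EuclideanSpace ℝ (Fin m))}
    (he : e ∈ IsManifold.maximalAtlas (𝓡 m) ∞ M) {r : M → ℝ} (hr : LipschitzWith 1 r)
    {G : ℝ → ℝ} (hG : ContDiff ℝ 1 G) {K : Set (EuclideanSpace ℝ (Fin m))} (hK : IsCompact K)
    (hKe : K ⊆ e.target) :
    ∃ (η : EuclideanSpace ℝ (Fin m) → ℝ) (D : ℝ≥0), LipschitzWith D η ∧
      (∀ y ∈ K, η y = G (r (e.symm y))) ∧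
      ∀ᵐ y, y ∈ K → ∀ v, lineDeriv ℝ η y v =
        deriv G (r (e.symm y)) * ⟪grad m r (e.symm y), coordVector e y v⟫_ℝ := by
  obtain ⟨ρ, D₁, O₁, hρ, hO₁, hKO₁, hO₁e, heq₁⟩ := exists_lipschitzWith_eqOn_nhds e.open_target hK
    hKe (locallyLipschitzOn_comp_symm he hr)
  -- `G` is only `C¹`, so composing with it leaves a locally Lipschitz function and a second
  -- extension is needed.
  have hGρ : LocallyLipschitz (G ∘ ρ) := (hG.locallyLipschitz).comp hρ.locallyLipschitz
  obtain ⟨η, D, O, hη, hO, hKO, hOO₁, heq⟩ := exists_lipschitzWith_eqOn_nhds hO₁ hK hKO₁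
    hGρ.locallyLipschitzOn
  refine ⟨η, D, hη, fun y hy => ?_, ?_⟩
  · rw [← heq (hKO hy), Function.comp, ← heq₁ (hKO₁ hy)]
  · filter_upwards [hρ.ae_differentiableAt] with y hy hyK v
    have hev : (fun z => r (e.symm z)) =ᶠ[𝓝 y] ρ := heq₁.eventuallyEq_of_mem
      (hO₁.mem_nhds (hKO₁ hyK))
    have hev' : (G ∘ ρ) =ᶠ[𝓝 y] η := heq.eventuallyEq_of_mem (hO.mem_nhds (hKO hyK))
    have hd : DifferentiableAt ℝ (fun z => r (e.symm z)) y := hev.differentiableAt_iff.2 hy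
    rw [inner_grad_coordVector he (hKe hyK) hd, hev.fderiv_eq,
      show r (e.symm y) = ρ y from hev.self_of_nhds]
    have h1 : HasFDerivAt (G ∘ ρ) (deriv G (ρ y) • fderiv ℝ ρ y) y :=
      (hG.differentiable one_ne_zero _).hasDerivAt.comp_hasFDerivAt y hy.hasFDerivAt
    have h2 : HasFDerivAt η (deriv G (ρ y) • fderiv ℝ ρ y) y := h1.congr_of_eventuallyEq hev'.symm
    rw [h2.differentiableAt.lineDeriv_eq_fderiv, h2.fderiv]
    rfl

/-- The chain and product rules for the weak gradient of `h(u) G(r)`. -/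
theorem IsWeakGradient.comp_mul_comp {u : M → ℝ} {X : (x : M) → TangentSpace (𝓡 m) x}
    (hu : IsWeakGradient u X) {h : ℝ → ℝ} (hh : ContDiff ℝ 1 h) {L : ℝ≥0}
    (hL : ∀ t, ‖deriv h t‖ ≤ L) {r : M → ℝ} (hr : LipschitzWith 1 r)
    {G : ℝ → ℝ} (hG : ContDiff ℝ 1 G) :
    IsWeakGradient (fun x => h (u x) * G (r x)) (fun x =>
      (deriv h (u x) * G (r x)) • X x + (h (u x) * deriv G (r x)) • grad m r x) := by
  have hhL : LipschitzWith L h := lipschitzWith_of_nnnorm_deriv_le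
    (hh.differentiable one_ne_zero) hL
  have hi : ∀ e ∈ IsManifold.maximalAtlas (𝓡 m) ∞ M, ∀ K ⊆ e.target, IsCompact K →
      IntegrableOn (fun y => h (u (e.symm y))) K volume := fun e he K hKe hK => by
    have h1 := (hu.locallyIntegrable e he).integrableOn_compact_subset hKe hK
    have hfin : IntegrableOn (fun _ : EuclideanSpace ℝ (Fin m) => |h 0|) K volume :=
      integrableOn_const hK.measure_lt_top.ne
    refine Integrable.mono' (hfin.add (h1.norm.const_mul (L : ℝ)))
      (hhL.continuous.comp_aestronglyMeasurable h1.aestronglyMeasurable)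
      (Eventually.of_forall fun y => ?_)
    have h2 : |h (u (e.symm y)) - h 0| ≤ L * |u (e.symm y)| := by
      simpa [Real.dist_eq] using hhL.dist_le_mul (u (e.symm y)) 0
    have := abs_sub_abs_le_abs_sub (h (u (e.symm y))) (h 0)
    simp only [Real.norm_eq_abs, Pi.add_apply]
    linarith
  have hinner : ∀ (e : OpenPartialHomeomorph M (EuclideanSpace ℝ (Fin m)))
      (y v : EuclideanSpace ℝ (Fin m)),
      ⟪(deriv h (u (e.symm y)) * G (r (e.symm y))) • X (e.symm y) +
        (h (u (e.symm y)) * deriv G (r (e.symm y))) • grad m r (e.symm y),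
        coordVector e y v⟫_ℝ =
      deriv h (u (e.symm y)) * ⟪X (e.symm y), coordVector e y v⟫_ℝ * G (r (e.symm y)) +
        h (u (e.symm y)) *
          (deriv G (r (e.symm y)) * ⟪grad m r (e.symm y), coordVector e y v⟫_ℝ) := by
    intro e y v
    rw [inner_add_left, real_inner_smul_left, real_inner_smul_left]
    ring
  refine ⟨fun e he => ?_, fun e he v => ?_, fun e he v ζ hζ hζc hζe => ?_⟩
  · rw [locallyIntegrableOn_iff e.open_target.isLocallyClosed]
    intro K hKe hK
    obtain ⟨η, D, hη, hηeq, -⟩ := exists_lipschitzWith_comp_symm he hr hG hK hKe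
    refine ((hi e he K hKe hK).mul_continuousOn hη.continuous.continuousOn hK).congr_fun
      (fun y hy => ?_) hK.measurableSet
    simp only [hηeq y hy]
  · rw [locallyIntegrableOn_iff e.open_target.isLocallyClosed]
    intro K hKe hK
    obtain ⟨η, D, hη, hηeq, hηd⟩ := exists_lipschitzWith_comp_symm he hr hG hK hKe
    have i1 : IntegrableOn (fun y => deriv h (u (e.symm y)) *
        ⟪X (e.symm y), coordVector e y v⟫_ℝ * η y) K volume := by
      refine IntegrableOn.mul_continuousOn ?_ hη.continuous.continuousOn hK
      refine Integrable.bdd_mul (c := L)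
        ((hu.locallyIntegrable_grad e he v).integrableOn_compact_subset hKe hK)
        ((hh.continuous_deriv le_rfl).comp_aestronglyMeasurable
          ((hu.locallyIntegrable e he).integrableOn_compact_subset hKe hK).aestronglyMeasurable)
        (Eventually.of_forall fun y => hL _)
    have i2 : IntegrableOn (fun y => h (u (e.symm y)) * lineDeriv ℝ η y v) K volume :=
      Integrable.mul_bdd (c := D * ‖v‖) (hi e he K hKe hK)
        (hη.locallyIntegrable_lineDeriv v).aestronglyMeasurable.restrict
        (Eventually.of_forall fun y => norm_lineDeriv_le_of_lipschitz ℝ hη)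
    refine Integrable.congr (i1.add i2) ?_
    filter_upwards [ae_restrict_mem hK.measurableSet, ae_restrict_of_ae hηd] with y hy hyd
    simp only [Pi.add_apply]
    rw [hinner, hyd hy, hηeq y hy]
  · obtain ⟨η, D, hη, hηeq, hηd⟩ := exists_lipschitzWith_comp_symm he hr hG hζc.isCompact hζe
    have key := HasWeakDerivOn.comp_mul_lipschitz (μ := volume) e.open_target
      (hu.locallyIntegrable e he) (hu.locallyIntegrable_grad e he v) (hu.integral_eq e he v)
      hh hL hη ζ hζ hζc hζe
    have e1 : ∫ y in e.target, h (u (e.symm y)) * G (r (e.symm y)) * fderiv ℝ ζ y v =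
        ∫ y in e.target, h (u (e.symm y)) * η y * fderiv ℝ ζ y v := by
      congr 1; ext y
      by_cases hy : y ∈ tsupport ζ
      · rw [hηeq y hy]
      · rw [image_eq_zero_of_notMem_tsupport (f := fderiv ℝ ζ) fun h =>
          hy (tsupport_fderiv_subset ℝ h)]
        simp
    rw [e1, key]
    congr 1
    refine integral_congr_ae (ae_restrict_of_ae ?_)
    filter_upwards [hηd] with y hyd
    by_cases hy : y ∈ tsupport ζ
    · rw [hinner, hyd hy, hηeq y hy]
    · simp [image_eq_zero_of_notMem_tsupport hy]

end

/-! ### Measurability and the Riemannian volume. -/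

/-- The superposition of a Carathéodory function and a measurable function is measurable. -/
theorem aemeasurable_comp_of_ae_continuous {α ι β : Type*} [MeasurableSpace α] {μ : Measure α}
    [TopologicalSpace ι] [TopologicalSpace.PseudoMetrizableSpace ι] [SecondCountableTopology ι]
    [MeasurableSpace ι] [BorelSpace ι]
    [TopologicalSpace β] [TopologicalSpace.PseudoMetrizableSpace β] [MeasurableSpace β]
    [BorelSpace β] {F : α → ι → β} (hF : ∀ i, AEMeasurable (fun x => F x i) μ)
    (hc : ∀ᵐ x ∂μ, Continuous (F x)) {s : α → ι} (hs : AEMeasurable s μ) :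
    AEMeasurable (fun x => F x (s x)) μ := by
  have hs' : StronglyMeasurable (hs.mk s) := hs.measurable_mk.stronglyMeasurable
  refine AEMeasurable.congr (f := fun x => F x (hs.mk s x)) ?_ ?_
  swap
  · filter_upwards [hs.ae_eq_mk] with x hx
    rw [hx]
  -- Along simple approximations of `s` only finitely many values of the second variable occur;
  -- continuity of `F x` handles the limit.
  refine aemeasurable_of_tendsto_metrizable_ae (u := atTop)
    (f := fun (n : ℕ) x => F x (hs'.approx n x)) (fun n => ?_) ?_
  · refine ⟨fun x => (hF (hs'.approx n x)).mk _ x,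
      SimpleFunc.measurable_bind (hs'.approx n) (fun i x => (hF i).mk _ x)
        fun i => (hF i).measurable_mk, ?_⟩
    have h : ∀ᵐ x ∂μ, ∀ i ∈ (hs'.approx n).range, F x i = (hF i).mk _ x :=
      (ae_ball_iff (Finset.countable_toSet _)).2 fun i _ => (hF i).ae_eq_mk
    filter_upwards [h] with x hx using hx _ (SimpleFunc.mem_range_self _ x)
  · filter_upwards [hc] with x hx
    exact (hx.tendsto _).comp (hs'.tendsto_approx x)

section Volume

variable {m : ℕ} {M : Type*} [TopologicalSpace M] [MeasurableSpace M]

theorem measurableSet_source_inter_preimage [OpensMeasurableSpace M]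
    (e : OpenPartialHomeomorph M (EuclideanSpace ℝ (Fin m)))
    {B : Set (EuclideanSpace ℝ (Fin m))} (hB : MeasurableSet B) :
    MeasurableSet (e.source ∩ e ⁻¹' B) := by
  have h1 := (continuousOn_iff_continuous_domRestrict.1 e.continuousOn).measurable hB
  have h2 := e.open_source.measurableSet.subtype_image h1
  convert h2 using 1
  ext x
  simp [and_comm]

variable [ChartedSpace (EuclideanSpace ℝ (Fin m)) M]
  [RiemannianBundle (fun x : M => TangentSpace (𝓡 m) x)]

/-- If all chart volumes vanish on `N`, the measure `⊤` restricted to `Nᶜ` bounds them and hence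
their supremum. No compatibility between chart volumes is used. -/
theorem riemannianVolume_eq_zero {N : Set M} (hN : MeasurableSet N)
    (h : ∀ e ∈ IsManifold.maximalAtlas (𝓡 m) ∞ M, chartVolume e N = 0) :
    riemannianVolume m M N = 0 := by
  have hle : riemannianVolume m M ≤ (⊤ : Measure M).restrict Nᶜ := by
    refine iSup₂_le fun e he => ?_
    rw [← Measure.restrict_eq_self_of_ae_mem (μ := chartVolume e) (s := Nᶜ)
      (measure_eq_zero_iff_ae_notMem.1 (h e he))]
    exact Measure.restrict_mono le_rfl le_top
  refine le_antisymm ((hle N).trans ?_) (zero_le)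
  simp [Measure.restrict_apply hN]

theorem chartVolume_eq_zero {e : OpenPartialHomeomorph M (EuclideanSpace ℝ (Fin m))} {N : Set M}
    (hN : MeasurableSet N) (h : volume (e.target ∩ e.symm ⁻¹' N) = 0) : chartVolume e N = 0 := by
  unfold chartVolume
  set ν := (volume.restrict e.target).withDensity
    fun y => ENNReal.ofReal √(gramMatrix e y).det with hν
  by_cases hm : AEMeasurable e.symm ν
  · rw [Measure.map_apply_of_aemeasurable hm hN]
    refine withDensity_absolutelyContinuous _ _ ?_
    rwa [Measure.restrict_apply₀' e.open_target.measurableSet.nullMeasurableSet, inter_comm]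
  -- The image measure is zero by convention, so measurability of `e.symm` need not be checked.
  · rw [Measure.map_of_not_aemeasurable hm]
    rfl

variable [IsManifold (𝓡 m) ∞ M] [OpensMeasurableSpace M]

/-- In any other chart the set is contained in the image of a null set under a differentiable
transition map, hence is null. -/
theorem riemannianVolume_source_inter_preimage_eq_zero
    {e : OpenPartialHomeomorph M (EuclideanSpace ℝ (Fin m))}
    (he : e ∈ IsManifold.maximalAtlas (𝓡 m) ∞ M) {B : Set (EuclideanSpace ℝ (Fin m))}
    (hB : volume B = 0) : riemannianVolume m M (e.source ∩ e ⁻¹' B) = 0 := by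
  set B' := toMeasurable volume B with hB'
  have hB'0 : volume B' = 0 := by rw [hB', measure_toMeasurable, hB]
  refine measure_mono_null (t := e.source ∩ e ⁻¹' B')
    (inter_subset_inter_right _ (preimage_mono (subset_toMeasurable _ _))) ?_
  have hN := measurableSet_source_inter_preimage e (measurableSet_toMeasurable volume B)
  refine riemannianVolume_eq_zero hN fun e' he' => chartVolume_eq_zero hN ?_
  have hd : DifferentiableOn ℝ (fun y => e' (e.symm y))
      (B' ∩ (e.target ∩ e.symm ⁻¹' e'.source)) := fun y hy =>
    (((mdifferentiable_of_mem_maximalAtlas he').mdifferentiableAt hy.2.2).comp y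
      ((mdifferentiable_of_mem_maximalAtlas he).mdifferentiableAt_symm
        hy.2.1)).differentiableAt.differentiableWithinAt
  refine measure_mono_null ?_ (addHaar_image_eq_zero_of_differentiableOn_of_addHaar_eq_zero volume
    hd (measure_mono_null inter_subset_left hB'0))
  rintro z ⟨hz, hz1, hz2⟩
  refine ⟨e (e'.symm z), ⟨hz2, e.map_source hz1, ?_⟩, ?_⟩
  · rw [mem_preimage, e.left_inv hz1]; exact e'.map_target hz
  · simp only
    rw [e.left_inv hz1, e'.right_inv hz]

/-- Countably many chart domains cover `M`; on each, `F` agrees with a measurable representative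
read through `e`, off a set that is null by the preceding lemma. -/
theorem aemeasurable_riemannianVolume [SecondCountableTopology M] {F : M → ℝ}
    (h : ∀ e ∈ IsManifold.maximalAtlas (𝓡 m) ∞ M,
      AEMeasurable (fun y => F (e.symm y)) (volume.restrict e.target)) :
    AEMeasurable F (riemannianVolume m M) := by
  obtain ⟨s, hs, hcov⟩ := TopologicalSpace.countable_cover_nhds
    (f := fun x : M => (chartAt (EuclideanSpace ℝ (Fin m)) x).source)
    (fun x => (chartAt (EuclideanSpace ℝ (Fin m)) x).open_source.mem_nhds (mem_chart_source _ x))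
  have := hs.to_subtype
  rw [biUnion_eq_iUnion] at hcov
  rw [← Measure.restrict_univ (μ := riemannianVolume m M), ← hcov, aemeasurable_iUnion_iff]
  rintro ⟨x, -⟩
  set e := chartAt (EuclideanSpace ℝ (Fin m)) x with hedef
  have he : e ∈ IsManifold.maximalAtlas (𝓡 m) ∞ M := IsManifold.chart_mem_maximalAtlas x
  have hF := h e he
  have hcomp : AEMeasurable (fun z => hF.mk _ (e z)) ((riemannianVolume m M).restrict e.source) :=
    hF.measurable_mk.comp_aemeasurable
      (e.continuousOn.aemeasurable e.open_source.measurableSet)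
  refine hcomp.congr (EventuallyEq.symm ?_)
  have h0 : ∀ᵐ y ∂volume, y ∈ e.target → F (e.symm y) = hF.mk _ y :=
    (ae_restrict_iff' e.open_target.measurableSet).1 hF.ae_eq_mk
  have h1 := riemannianVolume_source_inter_preimage_eq_zero he (ae_iff.1 h0)
  rw [EventuallyEq, ae_restrict_iff' e.open_source.measurableSet, ae_iff]
  refine measure_mono_null (fun z hz => ?_) h1
  simp only [Classical.not_imp, mem_ofPred_eq] at hz
  refine ⟨hz.1, ?_⟩
  simp only [mem_preimage, mem_ofPred_eq, Classical.not_imp]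
  refine ⟨e.map_source hz.1, ?_⟩
  rw [e.left_inv hz.1]
  exact hz.2

end Volume

/-! ### Measurable vector fields. -/

section ChartMeasurable

variable {m : ℕ} {M : Type*} [TopologicalSpace M] [ChartedSpace (EuclideanSpace ℝ (Fin m)) M]
  [RiemannianBundle (fun x : M => TangentSpace (𝓡 m) x)]

/-- A vector field whose covariant components are measurable in every chart. -/
def IsChartMeasurable (X : (x : M) → TangentSpace (𝓡 m) x) : Prop :=
  ∀ e ∈ IsManifold.maximalAtlas (𝓡 m) ∞ M, ∀ v : EuclideanSpace ℝ (Fin m),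
    AEMeasurable (fun y => ⟪X (e.symm y), coordVector e y v⟫_ℝ) (volume.restrict e.target)

theorem IsWeakGradient.isChartMeasurable {u : M → ℝ} {X : (x : M) → TangentSpace (𝓡 m) x}
    (h : IsWeakGradient u X) : IsChartMeasurable X := fun e he v =>
  (h.locallyIntegrable_grad e he v).aestronglyMeasurable.aemeasurable

theorem inner_coordVector_eq_sum (e : OpenPartialHomeomorph M (EuclideanSpace ℝ (Fin m)))
    (y v : EuclideanSpace ℝ (Fin m)) (ξ : TangentSpace (𝓡 m) (e.symm y)) :
    ⟪coordVector e y v, ξ⟫_ℝ = ∑ i, v i * ⟪coordVector e y (EuclideanSpace.single i 1), ξ⟫_ℝ := by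
  rw [coordVector_eq_sum, sum_inner]
  exact Finset.sum_congr rfl fun i _ => real_inner_smul_left _ _ _

variable [IsManifold (𝓡 m) ∞ M]
  {e : OpenPartialHomeomorph M (EuclideanSpace ℝ (Fin m))}

/-- A kernel vector of the Gram matrix gives a tangent vector of zero length, hence zero components.
-/
theorem isUnit_gramMatrix (he : e ∈ IsManifold.maximalAtlas (𝓡 m) ∞ M)
    {y : EuclideanSpace ℝ (Fin m)} (hy : y ∈ e.target) : IsUnit (gramMatrix e y) := by
  rw [← Matrix.mulVec_injective_iff_isUnit]
  refine (injective_iff_map_eq_zero (Matrix.mulVecLin (gramMatrix e y))).2 fun c hc => ?_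
  set v : EuclideanSpace ℝ (Fin m) := WithLp.toLp 2 c with hv
  have h0 : coordVector e y v = 0 := by
    rw [← inner_self_eq_zero (𝕜 := ℝ), inner_coordVector_eq_sum]
    refine Finset.sum_eq_zero fun i _ => ?_
    have hi : ∑ j, gramMatrix e y i j * c j = 0 := congr_fun hc i
    rw [real_inner_comm, inner_coordVector_eq_sum]
    have : ∑ j, v j * ⟪coordVector e y (EuclideanSpace.single j 1),
        coordVector e y (EuclideanSpace.single i 1)⟫_ℝ = ∑ j, gramMatrix e y i j * c j :=
      Finset.sum_congr rfl fun j _ => by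
        rw [real_inner_comm, mul_comm]; rfl
    rw [this, hi, mul_zero]
  have h1 := chartComponents_coordVector he hy v
  rw [h0] at h1
  have h2 : v = 0 := by
    rw [← h1]; exact map_zero (mfderiv (𝓡 m) (𝓡 m) e (e.symm y))
  ext i
  exact congr_arg (fun w : EuclideanSpace ℝ (Fin m) => w i) h2

theorem aemeasurable_inner_of_chartComponents {X Y : (x : M) → TangentSpace (𝓡 m) x}
    (he : e ∈ IsManifold.maximalAtlas (𝓡 m) ∞ M)
    (hX : AEMeasurable (fun y => chartComponents e y (X (e.symm y))) (volume.restrict e.target))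
    (hY : IsChartMeasurable Y) :
    AEMeasurable (fun y => ⟪X (e.symm y), Y (e.symm y)⟫_ℝ) (volume.restrict e.target) := by
  have h1 : AEMeasurable (fun y => ∑ i, chartComponents e y (X (e.symm y)) i *
      ⟪coordVector e y (EuclideanSpace.single i 1), Y (e.symm y)⟫_ℝ)
      (volume.restrict e.target) := by
    refine Finset.aemeasurable_fun_sum _ fun i _ => AEMeasurable.mul ?_ ?_
    · exact (EuclideanSpace.proj (𝕜 := ℝ) i).measurable.comp_aemeasurable hX
    · exact (hY e he _).congr (Eventually.of_forall fun y => real_inner_comm _ _)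
  refine h1.congr ?_
  filter_upwards [ae_restrict_mem e.open_target.measurableSet] with y hy
  conv_rhs => rw [← coordVector_chartComponents he hy (X (e.symm y))]
  rw [inner_coordVector_eq_sum]

variable [IsContMDiffRiemannianBundle (𝓡 m) ∞ (EuclideanSpace ℝ (Fin m))
    (fun x : M => TangentSpace (𝓡 m) x)]

theorem continuousOn_gramMatrix_inv (he : e ∈ IsManifold.maximalAtlas (𝓡 m) ∞ M) :
    ContinuousOn (fun y => (gramMatrix e y)⁻¹) e.target := by
  have hg : ContinuousOn (gramMatrix e) e.target :=
    continuousOn_pi.2 fun i => continuousOn_pi.2 fun j => continuousOn_inner_coordVector he _ _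
  have hdet : ContinuousOn (fun y => ((gramMatrix e y).det)⁻¹) e.target :=
    ((continuous_id.matrix_det).comp_continuousOn hg).inv₀ fun y hy =>
      ((Matrix.isUnit_iff_isUnit_det _).1 (isUnit_gramMatrix he hy)).ne_zero
  have hadj : ContinuousOn (fun y => (gramMatrix e y).adjugate) e.target :=
    (continuous_id.matrix_adjugate).comp_continuousOn hg
  refine (hdet.smul hadj).congr fun y _ => ?_
  simp [Matrix.inv_def]

/-- This raises an index: the components are the inverse Gram matrix, continuous in `y`, applied to
the covariant components. -/
theorem IsChartMeasurable.chartComponents {X : (x : M) → TangentSpace (𝓡 m) x}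
    (hX : IsChartMeasurable X) (he : e ∈ IsManifold.maximalAtlas (𝓡 m) ∞ M) :
    AEMeasurable (fun y => chartComponents e y (X (e.symm y))) (volume.restrict e.target) := by
  have hcomp : ∀ i, AEMeasurable (fun y => ∑ j, (gramMatrix e y)⁻¹ i j *
      ⟪X (e.symm y), coordVector e y (EuclideanSpace.single j 1)⟫_ℝ)
      (volume.restrict e.target) := fun i => by
    refine Finset.aemeasurable_fun_sum _ fun j _ => AEMeasurable.mul ?_ (hX e he _)
    have : ContinuousOn (fun y => (gramMatrix e y)⁻¹ i j) e.target :=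
      (continuous_apply_apply i j).comp_continuousOn (continuousOn_gramMatrix_inv he)
    exact this.aemeasurable e.open_target.measurableSet
  have h1 : AEMeasurable (fun y => WithLp.toLp 2 fun i => ∑ j, (gramMatrix e y)⁻¹ i j *
      ⟪X (e.symm y), coordVector e y (EuclideanSpace.single j 1)⟫_ℝ)
      (volume.restrict e.target) :=
    (WithLp.measurable_toLp 2 (Fin m → ℝ)).comp_aemeasurable (aemeasurable_pi_lambda _ hcomp)
  refine h1.congr ?_
  filter_upwards [ae_restrict_mem e.open_target.measurableSet] with y hy
  set c := RiemannianLiouville.chartComponents e y (X (e.symm y)) with hc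
  have hb : (fun j => ⟪X (e.symm y), coordVector e y (EuclideanSpace.single j 1)⟫_ℝ) =
      (gramMatrix e y).mulVec c.ofLp := by
    ext j
    rw [← coordVector_chartComponents he hy (X (e.symm y)), inner_coordVector_eq_sum]
    refine Finset.sum_congr rfl fun i _ => ?_
    rw [real_inner_comm, mul_comm]; rfl
  have hinv : (gramMatrix e y)⁻¹.mulVec ((gramMatrix e y).mulVec c.ofLp) = c.ofLp := by
    rw [Matrix.mulVec_mulVec, Matrix.nonsing_inv_mul _
      ((Matrix.isUnit_iff_isUnit_det _).1 (isUnit_gramMatrix he hy)), Matrix.one_mulVec]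
  rw [← hb] at hinv
  ext i
  exact congr_fun hinv i

theorem IsCaratheodory.isChartMeasurable
    {A : (x : M) → ℝ → TangentSpace (𝓡 m) x → TangentSpace (𝓡 m) x} (hA : IsCaratheodory A)
    {u : M → ℝ} (hu : ∀ e ∈ IsManifold.maximalAtlas (𝓡 m) ∞ M,
      AEMeasurable (fun y => u (e.symm y)) (volume.restrict e.target))
    {X : (x : M) → TangentSpace (𝓡 m) x} (hX : IsChartMeasurable X) :
    IsChartMeasurable fun x => A x (u x) (X x) := by
  intro e he v
  have h1 : AEMeasurable (fun y => localRep A e y (u (e.symm y))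
      (chartComponents e y (X (e.symm y)))) (volume.restrict e.target) :=
    aemeasurable_comp_of_ae_continuous
      (F := fun y (z : ℝ × EuclideanSpace ℝ (Fin m)) => localRep A e y z.1 z.2)
      (fun z => hA.measurable e he z.1 z.2) (hA.continuous e he)
      ((hu e he).prodMk (hX.chartComponents he))
  have h2 : AEMeasurable (fun y => ∑ i, localRep A e y (u (e.symm y))
      (chartComponents e y (X (e.symm y))) i *
        ⟪coordVector e y (EuclideanSpace.single i 1), coordVector e y v⟫_ℝ)
      (volume.restrict e.target) := by
    refine Finset.aemeasurable_fun_sum _ fun i _ => AEMeasurable.mul ?_ ?_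
    · exact (EuclideanSpace.proj (𝕜 := ℝ) i).measurable.comp_aemeasurable h1
    · exact (continuousOn_inner_coordVector he _ _).aemeasurable e.open_target.measurableSet
  refine h2.congr ?_
  filter_upwards [ae_restrict_mem e.open_target.measurableSet] with y hy
  rw [← inner_coordVector_eq_sum, localRep, coordVector_chartComponents he hy,
    coordVector_chartComponents he hy]

theorem IsChartMeasurable.aemeasurable_inner [MeasurableSpace M] [OpensMeasurableSpace M]
    [SecondCountableTopology M] {X Y : (x : M) → TangentSpace (𝓡 m) x}
    (hX : IsChartMeasurable X) (hY : IsChartMeasurable Y) :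
    AEMeasurable (fun x => ⟪X x, Y x⟫_ℝ) (riemannianVolume m M) :=
  aemeasurable_riemannianVolume fun _ he =>
    aemeasurable_inner_of_chartComponents he (hX.chartComponents he) hY

theorem IsChartMeasurable.aemeasurable_norm [MeasurableSpace M] [OpensMeasurableSpace M]
    [SecondCountableTopology M] {X : (x : M) → TangentSpace (𝓡 m) x}
    (hX : IsChartMeasurable X) :
    AEMeasurable (fun x => ‖X x‖) (riemannianVolume m M) := by
  simp_rw [norm_eq_sqrt_real_inner]
  exact Real.continuous_sqrt.measurable.comp_aemeasurable (hX.aemeasurable_inner hX)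

end ChartMeasurable

/-! ### The cut-off profile and scalar inequalities. -/

theorem hasDerivAt_max_zero_rpow {p : ℝ} (hp : 1 < p) (x : ℝ) :
    HasDerivAt (fun x => max x 0 ^ p) (p * max x 0 ^ (p - 1)) x := by
  rcases lt_trichotomy x 0 with hx | rfl | hx
  · rw [max_eq_right hx.le, Real.zero_rpow (by linarith), mul_zero]
    refine (hasDerivAt_const x (0 : ℝ)).congr_of_eventuallyEq ?_
    filter_upwards [Iio_mem_nhds hx] with y hy
    rw [max_eq_right (le_of_lt hy), Real.zero_rpow (by linarith)]
  · rw [max_self, Real.zero_rpow (by linarith), mul_zero]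
    -- At the corner the function is dominated by `|x|^p`, whose derivative at zero vanishes.
    have h := hasDerivAt_abs_rpow 0 hp
    rw [mul_zero, hasDerivAt_iff_isLittleO] at h
    rw [hasDerivAt_iff_isLittleO]
    refine (Asymptotics.isBigO_of_le _ fun y => ?_).trans_isLittleO h
    have h0 : (0 : ℝ) ^ p = 0 := Real.zero_rpow (by linarith)
    simp only [max_self, h0, abs_zero, smul_zero, sub_zero]
    rw [Real.norm_of_nonneg (by positivity), Real.norm_of_nonneg (by positivity)]
    exact Real.rpow_le_rpow (le_max_right _ _) (max_le (le_abs_self y) (abs_nonneg y)) (by linarith)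
  · rw [max_eq_left hx.le]
    refine (Real.hasDerivAt_rpow_const (Or.inl hx.ne')).congr_of_eventuallyEq ?_
    filter_upwards [Ioi_mem_nhds hx] with y hy
    rw [max_eq_left (le_of_lt hy)]

/-- The cut-off profile `(e^{-cs/p} - e^{-cR/p})₊^p`. -/
def cutoff (p c R s : ℝ) : ℝ :=
  max (Real.exp (-c * s / p) - Real.exp (-c * R / p)) 0 ^ p

/-- The `p` dividing the exponent cancels the outer power, leaving `-c w z^{p-1}` with `z = (w -
ε)₊`, the shape that `young_pointwise` pairs with `z^p`. -/
theorem hasDerivAt_cutoff {p : ℝ} (hp : 1 < p) (c R s : ℝ) :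
    HasDerivAt (cutoff p c R)
      (-c * Real.exp (-c * s / p) *
        max (Real.exp (-c * s / p) - Real.exp (-c * R / p)) 0 ^ (p - 1)) s := by
  have h1 : HasDerivAt (fun s => Real.exp (-c * s / p) - Real.exp (-c * R / p))
      (Real.exp (-c * s / p) * (-c / p)) s := by
    have := (((hasDerivAt_id s).const_mul (-c)).div_const p).exp.sub_const (Real.exp (-c * R / p))
    simpa using this
  have h2 := (hasDerivAt_max_zero_rpow hp _).comp s h1
  refine h2.congr_deriv ?_
  have : p ≠ 0 := by linarith
  field_simp

theorem contDiff_cutoff {p : ℝ} (hp : 1 < p) (c R : ℝ) : ContDiff ℝ 1 (cutoff p c R) := by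
  rw [contDiff_one_iff_deriv]
  refine ⟨fun s => (hasDerivAt_cutoff hp c R s).differentiableAt, ?_⟩
  have : deriv (cutoff p c R) = fun s => -c * Real.exp (-c * s / p) *
      max (Real.exp (-c * s / p) - Real.exp (-c * R / p)) 0 ^ (p - 1) :=
    funext fun s => (hasDerivAt_cutoff hp c R s).deriv
  rw [this]
  refine Continuous.mul (by fun_prop) (Continuous.rpow_const (by fun_prop) fun s => ?_)
  right; linarith

theorem cutoff_eq_zero {p c R s : ℝ} (hp : 1 < p) (hc : 0 < c) (hs : R ≤ s) :
    cutoff p c R s = 0 := by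
  rw [cutoff, max_eq_right, Real.zero_rpow (by linarith)]
  rw [sub_nonpos, Real.exp_le_exp]
  have : 0 < p := by linarith
  gcongr ?_ / p
  nlinarith

/-- The pointwise consequence of Young's inequality behind the energy estimate. -/
theorem young_pointwise {p lam b σ a z w t h h' : ℝ} (hp : 1 < p) (hlam : 0 < lam) (hb : 0 ≤ b)
    (hσ : 0 < σ) (ha : 0 ≤ a) (hz : 0 ≤ z) (hw : 0 ≤ w) (ht : 0 ≤ t) (hh : 0 ≤ h) (hh' : 0 ≤ h')
    (hσh : σ * h ≤ t * h') :
    b * a ^ ((p - 1) / p) * h * (w * z ^ (p - 1)) ≤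
      h' * a * z ^ p +
        b ^ p / (p * lam * (p / (p - 1)) ^ (p - 1)) / σ ^ (p - 1) * lam * t ^ (p - 1) * h * w ^ p := by
  have hp0 : 0 < p := by linarith
  have hp1 : 0 < p - 1 := by linarith
  rcases hh.eq_or_lt with rfl | hh
  · simp only [mul_zero, zero_mul, add_zero]
    positivity
  have hth : 0 < t * h' := (mul_pos hσ hh).trans_le hσh
  have ht : 0 < t := ht.lt_of_ne (by rintro rfl; simp at hth)
  have hh' : 0 < h' := hh'.lt_of_ne (by rintro rfl; simp at hth)
  have hpq : (p / (p - 1)).HolderConjugate p :=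
    (Real.HolderConjugate.conjExponent hp).symm
  set p' := p / (p - 1) with hp'
  have hp'0 : 0 < p' := by positivity
  -- `N` is normalized by `N^{p'} / p' = h'`, so that the first Young term is exactly the available
  -- `h' a z^p`.
  set N := (p' * h') ^ ((p - 1) / p) with hN
  have hN0 : 0 < N := by positivity
  have key := Real.young_inequality_of_nonneg (a := N * a ^ ((p - 1) / p) * z ^ (p - 1))
    (b := b * h * w / N) (by positivity) (by positivity) hpq
  have hx : (N * a ^ ((p - 1) / p) * z ^ (p - 1)) ^ p' / p' = h' * a * z ^ p := by
    rw [Real.mul_rpow (by positivity) (by positivity), Real.mul_rpow (by positivity) (by positivity),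
      hN, ← Real.rpow_mul (by positivity), ← Real.rpow_mul (by positivity),
      ← Real.rpow_mul (by positivity)]
    have e1 : (p - 1) / p * p' = 1 := by rw [hp']; field_simp
    have e2 : (p - 1) * p' = p := by rw [hp']; field_simp
    rw [e1, e2, Real.rpow_one, Real.rpow_one]
    field_simp
  have hy : (b * h * w / N) ^ p / p =
      b ^ p / (p * p' ^ (p - 1)) * (h / h') ^ (p - 1) * h * w ^ p := by
    rw [Real.div_rpow (by positivity) (by positivity), Real.mul_rpow (by positivity) hw,
      Real.mul_rpow hb hh.le, hN, ← Real.rpow_mul (by positivity)]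
    have e1 : (p - 1) / p * p = p - 1 := by field_simp
    have e2 : h ^ p = h ^ (p - 1) * h := by
      nth_rewrite 3 [← Real.rpow_one h]
      rw [← Real.rpow_add hh]; congr 1; ring
    rw [e1, Real.mul_rpow hp'0.le hh'.le, e2, Real.div_rpow hh.le hh'.le]
    field_simp
  have hl : N * a ^ ((p - 1) / p) * z ^ (p - 1) * (b * h * w / N) =
      b * a ^ ((p - 1) / p) * h * (w * z ^ (p - 1)) := by
    field_simp
  rw [hx, hy, hl] at key
  refine key.trans ?_
  refine add_le_add le_rfl ?_
  -- The hypothesis on `σ` trades `h / h'` for `t / σ`, which makes the remainder comparable with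
  -- the zeroth-order term of the equation.
  have hratio : (h / h') ^ (p - 1) ≤ (t / σ) ^ (p - 1) := by
    refine Real.rpow_le_rpow (by positivity) ?_ hp1.le
    rw [div_le_div_iff₀ hh' hσ]; linarith
  calc b ^ p / (p * p' ^ (p - 1)) * (h / h') ^ (p - 1) * h * w ^ p
      ≤ b ^ p / (p * p' ^ (p - 1)) * (t / σ) ^ (p - 1) * h * w ^ p := by gcongr
    _ = b ^ p / (p * lam * p' ^ (p - 1)) / σ ^ (p - 1) * lam * t ^ (p - 1) * h * w ^ p := by
      rw [Real.div_rpow ht.le hσ.le]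
      field_simp

/-- This is the `p`-th power of the bound on `c`, rearranged: the critical constant is the value at
which `κ = 1`. -/
theorem coercivity_ratio_lt {p lam k c al : ℝ} (hp : 1 < p) (hlam : 0 < lam) (hk : 0 < k)
    (hc : 0 < c) (hal : 0 < al)
    (h : c < p * al ^ (1 / Real.conjExponent p) / (p - 1) ^ (1 / Real.conjExponent p) *
      (lam ^ (1 / p) / k)) :
    (k * c) ^ p / (p * lam * (p / (p - 1)) ^ (p - 1)) < al ^ (p - 1) := by
  have hp0 : 0 < p := by linarith
  have hp1 : 0 < p - 1 := by linarith
  have he : 1 / Real.conjExponent p = (p - 1) / p := by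
    rw [Real.conjExponent, one_div_div]
  rw [he] at h
  have h1 : k * c < p * al ^ ((p - 1) / p) / (p - 1) ^ ((p - 1) / p) * lam ^ (1 / p) := by
    calc k * c < k * (p * al ^ ((p - 1) / p) / (p - 1) ^ ((p - 1) / p) * (lam ^ (1 / p) / k)) := by
          gcongr
      _ = _ := by field_simp
  have h2 := Real.rpow_lt_rpow (by positivity) h1 hp0
  generalize k * c = d at h2 ⊢
  rw [Real.mul_rpow (by positivity) (by positivity), Real.div_rpow (by positivity) (by positivity),
    Real.mul_rpow (by positivity) (by positivity), ← Real.rpow_mul hal.le,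
    ← Real.rpow_mul hp1.le, ← Real.rpow_mul hlam.le] at h2
  have e1 : (p - 1) / p * p = p - 1 := by field_simp
  have e2 : 1 / p * p = 1 := by field_simp
  have e3 : p ^ p = p ^ (p - 1) * p := by
    rw [Real.rpow_sub_one hp0.ne']; field_simp
  rw [e1, e2, e3, Real.rpow_one] at h2
  rw [div_lt_iff₀ (by positivity), Real.div_rpow hp0.le hp1.le]
  refine h2.trans_eq ?_
  field_simp

/-- Convexity of `t ↦ t^p` at `a + b = (1 - s) · a/(1 - s) + s · b/s`. -/
theorem add_rpow_le_weighted {p s a b : ℝ} (hp : 1 < p) (hs0 : 0 < s) (hs1 : s < 1)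
    (ha : 0 ≤ a) (hb : 0 ≤ b) :
    (a + b) ^ p ≤ (1 - s) ^ (1 - p) * a ^ p + s ^ (1 - p) * b ^ p := by
  have hs1' : 0 < 1 - s := by linarith
  have h := (convexOn_rpow hp.le).2 (x := a / (1 - s)) (y := b / s)
    (show 0 ≤ a / (1 - s) by positivity) (show 0 ≤ b / s by positivity) hs1'.le hs0.le (by ring)
  have e1 : (1 - s) • (a / (1 - s)) + s • (b / s) = a + b := by
    simp only [smul_eq_mul]; field_simp
  rw [e1] at h
  refine h.trans_eq ?_
  simp only [smul_eq_mul]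
  rw [Real.div_rpow ha hs1'.le, Real.div_rpow hb hs0.le, Real.rpow_sub hs1', Real.rpow_sub hs0,
    Real.rpow_one, Real.rpow_one]
  field_simp

/-! ### Truncated powers. -/

/-- Admissible truncations of the power `sign(t) |t|^al`. -/
structure IsPowerTruncation (al σ₀ : ℝ) (h : ℕ → ℝ → ℝ) (σ : ℕ → ℝ → ℝ) (H : ℝ → ℝ) : Prop where
  contDiff : ∀ n, ContDiff ℝ 1 (h n)
  exists_bound : ∀ n, ∃ L : ℝ≥0, ∀ t, ‖deriv (h n) t‖ ≤ L
  mul_nonneg : ∀ n t, 0 ≤ t * h n t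
  deriv_nonneg : ∀ n t, 0 ≤ deriv (h n) t
  abs_le : ∀ n t, |h n t| ≤ |t| ^ al
  le_ratio : ∀ n t, σ₀ ≤ σ n t
  ratio_mul_le : ∀ n t, σ n t * |h n t| ≤ |t| * deriv (h n) t
  continuous_ratio : ∀ n, Continuous (σ n)
  tendsto_ratio : ∀ t, Tendsto (fun n => σ n t) atTop (𝓝 al)
  tendsto_abs : ∀ t, Tendsto (fun n => |h n t|) atTop (𝓝 (H t))
  limit_pos : ∀ t, t ≠ 0 → 0 < H t

theorem hasDerivAt_mul_one_add_sq_rpow (γ t : ℝ) :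
    HasDerivAt (fun t : ℝ => t * (1 + t ^ 2) ^ (γ / 2))
      ((1 + t ^ 2) ^ (γ / 2) * (1 + γ * (t ^ 2 / (1 + t ^ 2)))) t := by
  have hD : 0 < 1 + t ^ 2 := by positivity
  have h1 : HasDerivAt (fun t : ℝ => 1 + t ^ 2) (2 * t) t := by
    simpa using (hasDerivAt_pow 2 t).const_add 1
  have h2 := (hasDerivAt_id t).mul (h1.rpow_const (p := γ / 2) (Or.inl hD.ne'))
  refine h2.congr_deriv ?_
  simp only [id]
  rw [Real.rpow_sub_one hD.ne']
  field_simp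

/-- For `al < 1` the power has unbounded derivative only near zero, and one smoothing there serves
for all `n`. The ratio `t h' / h = 1 + (al - 1) t²/(1 + t²)` is at least `al`, so `σ` can be
constant. The limit differs from `|t|^al`, but only positivity off zero and domination by `|t|^al`
matter. -/
theorem isPowerTruncation_of_le_one {al : ℝ} (hal0 : 0 < al) (hal1 : al ≤ 1) :
    IsPowerTruncation al al (fun _ t => t * (1 + t ^ 2) ^ ((al - 1) / 2)) (fun _ _ => al)
      (fun t => |t| * (1 + t ^ 2) ^ ((al - 1) / 2)) := by
  have hder : ∀ t : ℝ, deriv (fun t : ℝ => t * (1 + t ^ 2) ^ ((al - 1) / 2)) t =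
      (1 + t ^ 2) ^ ((al - 1) / 2) * (1 + (al - 1) * (t ^ 2 / (1 + t ^ 2))) :=
    fun t => (hasDerivAt_mul_one_add_sq_rpow _ t).deriv
  have hfrac : ∀ t : ℝ, 0 ≤ t ^ 2 / (1 + t ^ 2) ∧ t ^ 2 / (1 + t ^ 2) ≤ 1 := fun t =>
    ⟨by positivity, by rw [div_le_one (by positivity)]; linarith⟩
  have hbr : ∀ t : ℝ, al ≤ 1 + (al - 1) * (t ^ 2 / (1 + t ^ 2)) ∧
      1 + (al - 1) * (t ^ 2 / (1 + t ^ 2)) ≤ 1 := fun t => by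
    obtain ⟨h1, h2⟩ := hfrac t
    constructor <;> nlinarith
  have hpow : ∀ t : ℝ, 0 < (1 + t ^ 2) ^ ((al - 1) / 2) := fun t => by positivity
  have habs : ∀ t : ℝ, |t * (1 + t ^ 2) ^ ((al - 1) / 2)| =
      |t| * (1 + t ^ 2) ^ ((al - 1) / 2) := fun t => by
    rw [abs_mul, abs_of_pos (hpow t)]
  refine ⟨fun _ => ?_, fun _ => ⟨1, fun t => ?_⟩, fun _ t => ?_, fun _ t => ?_, fun _ t => ?_,
    fun _ t => le_rfl, fun _ t => ?_, fun _ => continuous_const, fun t => tendsto_const_nhds,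
    fun t => ?_, fun t ht => ?_⟩
  · refine contDiff_id.mul (ContDiff.rpow_const_of_ne (by fun_prop) fun t => ?_)
    positivity
  · rw [hder, Real.norm_of_nonneg (mul_nonneg (hpow t).le (hal0.le.trans (hbr t).1))]
    refine mul_le_one₀ ?_ (hal0.le.trans (hbr t).1) (hbr t).2
    exact Real.rpow_le_one_of_one_le_of_nonpos (by nlinarith [sq_nonneg t]) (by linarith)
  · rw [← mul_assoc, ← sq]
    positivity
  · rw [hder]
    exact mul_nonneg (hpow t).le (hal0.le.trans (hbr t).1)
  · rw [habs]
    rcases eq_or_ne t 0 with rfl | ht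
    · simp [Real.zero_rpow hal0.ne']
    have ht' : 0 < |t| := abs_pos.2 ht
    have h1 : (1 + t ^ 2) ^ ((al - 1) / 2) ≤ (|t| ^ 2) ^ ((al - 1) / 2) :=
      Real.rpow_le_rpow_of_nonpos (by positivity) (by rw [sq_abs]; linarith) (by linarith)
    rw [← Real.rpow_natCast |t| 2, ← Real.rpow_mul ht'.le] at h1
    calc |t| * (1 + t ^ 2) ^ ((al - 1) / 2) ≤ |t| * |t| ^ (((2 : ℕ) : ℝ) * ((al - 1) / 2)) := by
          gcongr
      _ = |t| ^ al := by
          nth_rewrite 1 [← Real.rpow_one |t|]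
          rw [← Real.rpow_add ht']
          congr 1; push_cast; ring
  · rw [hder, habs]
    calc al * (|t| * (1 + t ^ 2) ^ ((al - 1) / 2)) =
        |t| * ((1 + t ^ 2) ^ ((al - 1) / 2) * al) := by ring
      _ ≤ _ := by
        gcongr
        exact (hbr t).1
  · simp_rw [habs]
    exact tendsto_const_nhds
  · have := abs_pos.2 ht
    positivity

/-- The odd extension of `t ↦ t ^ al`. -/
def signedRpow (al t : ℝ) : ℝ := max t 0 ^ al - max (-t) 0 ^ al

theorem hasDerivAt_signedRpow {al : ℝ} (hal : 1 < al) (t : ℝ) :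
    HasDerivAt (signedRpow al) (al * |t| ^ (al - 1)) t := by
  have h1 := (hasDerivAt_max_zero_rpow hal t).sub
    ((hasDerivAt_max_zero_rpow hal (-t)).comp t (hasDerivAt_neg t))
  refine h1.congr_deriv ?_
  have h0 : (0 : ℝ) ^ (al - 1) = 0 := Real.zero_rpow (by linarith)
  rcases le_total 0 t with ht | ht
  · rw [max_eq_left ht, max_eq_right (by linarith), h0, abs_of_nonneg ht]; ring
  · rw [max_eq_right ht, max_eq_left (by linarith), h0, abs_of_nonpos ht]; ring

theorem abs_signedRpow {al : ℝ} (hal : 0 < al) (t : ℝ) : |signedRpow al t| = |t| ^ al := by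
  have h0 : (0 : ℝ) ^ al = 0 := Real.zero_rpow hal.ne'
  rcases le_total 0 t with ht | ht
  · rw [signedRpow, max_eq_left ht, max_eq_right (by linarith), h0, sub_zero,
      abs_of_nonneg (by positivity), abs_of_nonneg ht]
  · have : 0 ≤ (-t) ^ al := Real.rpow_nonneg (by linarith) _
    rw [signedRpow, max_eq_right ht, max_eq_left (by linarith), h0, zero_sub, abs_neg,
      abs_of_nonneg this, abs_of_nonpos ht]

theorem mul_signedRpow {al : ℝ} (hal : 0 < al) (t : ℝ) :
    t * signedRpow al t = |t| * |t| ^ al := by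
  have h0 : (0 : ℝ) ^ al = 0 := Real.zero_rpow hal.ne'
  rcases le_total 0 t with ht | ht
  · rw [signedRpow, max_eq_left ht, max_eq_right (by linarith), h0, abs_of_nonneg ht]; ring
  · rw [signedRpow, max_eq_right ht, max_eq_left (by linarith), h0, abs_of_nonpos ht]; ring

theorem hasDerivAt_signedRpow_mul {al b : ℝ} (hal : 1 < al) (hb : 0 < b) (t : ℝ) :
    HasDerivAt (fun t => signedRpow al t * (1 + b * t ^ 2) ^ (-((al - 1) / 2)))
      (|t| ^ (al - 1) * (1 + b * t ^ 2) ^ (-((al - 1) / 2)) *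
        (1 + (al - 1) / (1 + b * t ^ 2))) t := by
  have hD : 0 < 1 + b * t ^ 2 := by positivity
  have h1 : HasDerivAt (fun t : ℝ => 1 + b * t ^ 2) (b * (2 * t)) t := by
    simpa using ((hasDerivAt_pow 2 t).const_mul b).const_add 1
  have h2 := (hasDerivAt_signedRpow hal t).mul
    (h1.rpow_const (p := -((al - 1) / 2)) (Or.inl hD.ne'))
  refine h2.congr_deriv ?_
  have h3 : |t| * |t| ^ al = t ^ 2 * |t| ^ (al - 1) := by
    rcases eq_or_ne t 0 with rfl | ht
    · simp
    have ht' : 0 < |t| := abs_pos.2 ht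
    rw [Real.rpow_sub_one ht'.ne', ← sq_abs t]
    field_simp
  rw [Real.rpow_sub_one hD.ne']
  have h4 := mul_signedRpow (by linarith : 0 < al) t
  rw [h3] at h4
  generalize (1 + b * t ^ 2) ^ (-((al - 1) / 2)) = P
  generalize |t| ^ (al - 1) = Q at h4 ⊢
  have h5 : signedRpow al t * (b * (2 * t) * -((al - 1) / 2) * (P / (1 + b * t ^ 2))) =
      -(al - 1) * b * (t ^ 2 * Q) * P / (1 + b * t ^ 2) := by
    rw [← h4]; ring
  rw [h5]
  field_simp
  ring

/-- For `al > 1` the derivative is unbounded only at infinity; the extra factor makes `h n`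
asymptotically linear. The ratio `t h' / h` equals `1 + (al - 1)/(1 + t²/(n + 1))`, which stays
above `1` and tends to `al`. -/
theorem isPowerTruncation_of_one_lt {al : ℝ} (hal : 1 < al) :
    IsPowerTruncation al 1
      (fun n t => signedRpow al t * (1 + 1 / ((n : ℝ) + 1) * t ^ 2) ^ (-((al - 1) / 2)))
      (fun n t => 1 + (al - 1) / (1 + 1 / ((n : ℝ) + 1) * t ^ 2)) (fun t => |t| ^ al) := by
  have hal0 : 0 < al := by linarith
  have hb : ∀ n : ℕ, 0 < 1 / ((n : ℝ) + 1) := fun n => by positivity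
  have hD : ∀ (n : ℕ) (t : ℝ), 1 ≤ 1 + 1 / ((n : ℝ) + 1) * t ^ 2 := fun n t => by
    have : 0 ≤ 1 / ((n : ℝ) + 1) * t ^ 2 := by positivity
    linarith
  have hP : ∀ (n : ℕ) (t : ℝ), 0 < (1 + 1 / ((n : ℝ) + 1) * t ^ 2) ^ (-((al - 1) / 2)) :=
    fun n t => Real.rpow_pos_of_pos (by linarith [hD n t]) _
  have hσ : ∀ (n : ℕ) (t : ℝ), 0 ≤ (al - 1) / (1 + 1 / ((n : ℝ) + 1) * t ^ 2) := fun n t =>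
    div_nonneg (by linarith) (by linarith [hD n t])
  have hder : ∀ (n : ℕ) (t : ℝ), deriv (fun t =>
      signedRpow al t * (1 + 1 / ((n : ℝ) + 1) * t ^ 2) ^ (-((al - 1) / 2))) t =
      |t| ^ (al - 1) * (1 + 1 / ((n : ℝ) + 1) * t ^ 2) ^ (-((al - 1) / 2)) *
        (1 + (al - 1) / (1 + 1 / ((n : ℝ) + 1) * t ^ 2)) := fun n t =>
    (hasDerivAt_signedRpow_mul hal (hb n) t).deriv
  have habs : ∀ (n : ℕ) (t : ℝ),
      |signedRpow al t * (1 + 1 / ((n : ℝ) + 1) * t ^ 2) ^ (-((al - 1) / 2))| =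
      |t| ^ al * (1 + 1 / ((n : ℝ) + 1) * t ^ 2) ^ (-((al - 1) / 2)) := fun n t => by
    rw [abs_mul, abs_of_pos (hP n t), abs_signedRpow hal0]
  have hcD : ∀ n : ℕ, Continuous fun t : ℝ => 1 + 1 / ((n : ℝ) + 1) * t ^ 2 := fun n => by fun_prop
  have hlimD : ∀ t : ℝ, Tendsto (fun n : ℕ => 1 + 1 / ((n : ℝ) + 1) * t ^ 2) atTop (𝓝 1) :=
    fun t => by
      simpa using ((tendsto_one_div_add_atTop_nhds_zero_nat (𝕜 := ℝ)).mul_const (t ^ 2)).const_add 1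
  have hcσ : ∀ n : ℕ, Continuous fun t : ℝ => 1 + (al - 1) / (1 + 1 / ((n : ℝ) + 1) * t ^ 2) :=
    fun n => continuous_const.add (continuous_const.div (hcD n) fun t => by
      linarith [hD n t])
  refine ⟨fun n => ?_, fun n => ⟨⟨(1 / (1 / ((n : ℝ) + 1))) ^ ((al - 1) / 2) * al, by positivity⟩,
    fun t => ?_⟩, fun n t => ?_, fun n t => ?_, fun n t => ?_,
    fun n t => by linarith [hσ n t], fun n t => ?_, hcσ, fun t => ?_,
    fun t => ?_, fun t ht => ?_⟩
  · rw [contDiff_one_iff_deriv]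
    refine ⟨fun t => (hasDerivAt_signedRpow_mul hal (hb n) t).differentiableAt, ?_⟩
    rw [funext (hder n)]
    refine (Continuous.mul ?_ ?_).mul (hcσ n)
    · exact continuous_abs.rpow_const fun t => Or.inr (by linarith)
    · exact (hcD n).rpow_const fun t => Or.inl (by linarith [hD n t])
  · rw [hder, Real.norm_of_nonneg (mul_nonneg (mul_nonneg (by positivity) (hP n t).le)
      (by linarith [hσ n t]))]
    have hD0 : 0 < 1 + 1 / ((n : ℝ) + 1) * t ^ 2 := by linarith [hD n t]
    have h1 : |t| ^ (al - 1) * (1 + 1 / ((n : ℝ) + 1) * t ^ 2) ^ (-((al - 1) / 2)) =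
        (t ^ 2 / (1 + 1 / ((n : ℝ) + 1) * t ^ 2)) ^ ((al - 1) / 2) := by
      rw [Real.div_rpow (by positivity) hD0.le, Real.rpow_neg hD0.le, ← sq_abs t,
        ← Real.rpow_natCast |t| 2, ← Real.rpow_mul (abs_nonneg t), div_eq_mul_inv]
      congr 2
      push_cast; ring
    rw [h1]
    refine mul_le_mul ?_ ?_ (by linarith [hσ n t]) (by positivity)
    · refine Real.rpow_le_rpow (by positivity) ?_ (by linarith)
      rw [div_le_div_iff₀ hD0 (hb n)]
      nlinarith [hb n]
    · have : (al - 1) / (1 + 1 / ((n : ℝ) + 1) * t ^ 2) ≤ al - 1 :=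
        div_le_self (by linarith) (hD n t)
      linarith
  · rw [← mul_assoc, mul_signedRpow hal0]
    exact mul_nonneg (by positivity) (hP n t).le
  · rw [hder]
    exact mul_nonneg (mul_nonneg (by positivity) (hP n t).le) (by linarith [hσ n t])
  · rw [habs]
    refine mul_le_of_le_one_right (by positivity) ?_
    exact Real.rpow_le_one_of_one_le_of_nonpos (hD n t) (by linarith)
  · rw [hder, habs]
    refine le_of_eq ?_
    rcases eq_or_ne t 0 with rfl | ht
    · simp [Real.zero_rpow hal0.ne']
    have ht' : 0 < |t| := abs_pos.2 ht
    rw [Real.rpow_sub_one ht'.ne']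
    field_simp
  · have := (tendsto_const_nhds (x := al - 1)).div (hlimD t) one_ne_zero
    simpa using this.const_add 1
  · simp_rw [habs]
    have := ((hlimD t).rpow_const (p := -((al - 1) / 2)) (Or.inl one_ne_zero)).const_mul (|t| ^ al)
    simpa using this
  · exact Real.rpow_pos_of_pos (abs_pos.2 ht) _

theorem exists_isPowerTruncation {al : ℝ} (hal : 0 < al) :
    ∃ σ₀ > 0, ∃ h σ H, IsPowerTruncation al σ₀ h σ H := by
  rcases le_or_gt al 1 with h | h
  · exact ⟨al, hal, _, _, _, isPowerTruncation_of_le_one hal h⟩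
  · exact ⟨1, one_pos, _, _, _, isPowerTruncation_of_one_lt h⟩

namespace IsPowerTruncation

variable {al σ₀ : ℝ} {h σ : ℕ → ℝ → ℝ} {H : ℝ → ℝ}

theorem limit_nonneg (hT : IsPowerTruncation al σ₀ h σ H) (t : ℝ) : 0 ≤ H t :=
  ge_of_tendsto' (hT.tendsto_abs t) fun _ => abs_nonneg _

theorem measurable_limit (hT : IsPowerTruncation al σ₀ h σ H) : Measurable H :=
  measurable_of_tendsto_metrizable (fun n => (hT.contDiff n).continuous.abs.measurable)
    (tendsto_pi_nhds.2 hT.tendsto_abs)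

theorem rpow_mul_abs_le {p q : ℝ} (hp : 1 < p) (hq : p - 1 < q)
    (hT : IsPowerTruncation (q - p + 1) σ₀ h σ H) (n : ℕ) (t : ℝ) :
    |t| ^ (p - 1) * |h n t| ≤ |t| ^ q := by
  have h1 : |t| ^ q = |t| ^ (p - 1) * |t| ^ (q - p + 1) := by
    rw [← Real.rpow_add_of_nonneg (abs_nonneg t) (by linarith) (by linarith)]
    congr 1; ring
  rw [h1]
  gcongr
  exact hT.abs_le n t

theorem rpow_mul_limit_le {p q : ℝ} (hp : 1 < p) (hq : p - 1 < q)
    (hT : IsPowerTruncation (q - p + 1) σ₀ h σ H) (t : ℝ) :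
    |t| ^ (p - 1) * H t ≤ |t| ^ q :=
  le_of_tendsto' ((hT.tendsto_abs t).const_mul _) fun n => hT.rpow_mul_abs_le hp hq n t

end IsPowerTruncation

theorem exists_absorption (p : ℝ) {κ : ℝ} (hκ : κ < 1) :
    ∃ s, 0 < s ∧ s < 1 ∧ κ * (1 - s) ^ (1 - p) < 1 := by
  have h1 : Tendsto (fun s : ℝ => κ * (1 - s) ^ (1 - p)) (𝓝 0) (𝓝 (κ * (1 - 0) ^ (1 - p))) :=
    ((tendsto_const_nhds.sub tendsto_id).rpow_const (Or.inl (by norm_num))).const_mul κ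
  simp only [sub_zero, Real.one_rpow, mul_one] at h1
  have h2 := (h1.mono_left nhdsWithin_le_nhds : Tendsto _ (𝓝[>] (0 : ℝ)) _).eventually_lt_const hκ
  have h3 : ∀ᶠ s : ℝ in 𝓝[>] 0, s < 1 := nhdsWithin_le_nhds (gt_mem_nhds one_pos)
  obtain ⟨s, h4, h5, h6⟩ := (h2.and (h3.and self_mem_nhdsWithin)).exists
  exact ⟨s, h6, h5, h4⟩

/-! ### From energy inequalities to vanishing. -/

section Energy

variable {α : Type*} [MeasurableSpace α] {μ : Measure α} {u r : α → ℝ}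

/-- Passage to the limit in the truncation. -/
theorem energy_limit_nonpos {p q c R Θ σ₀ : ℝ} (hp : 1 < p) (hq : p - 1 < q) (hc : 0 < c)
    (hΘ : 0 ≤ Θ) (hσ₀ : 0 < σ₀) {h σ : ℕ → ℝ → ℝ} {H : ℝ → ℝ}
    (hT : IsPowerTruncation (q - p + 1) σ₀ h σ H)
    (hu : AEMeasurable u μ) (hr : Measurable r) (hr0 : ∀ x, 0 ≤ r x)
    (hint : IntegrableOn (fun x => |u x| ^ q) {x | r x < R} μ)
    (henergy : ∀ n, ∫ x in {x | r x < R}, |u x| ^ (p - 1) * |h n (u x)| *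
      ((Real.exp (-c * r x / p) - Real.exp (-c * R / p)) ^ p -
        Θ / σ n (u x) ^ (p - 1) * Real.exp (-c * r x / p) ^ p) ∂μ ≤ 0) :
    ∫ x in {x | r x < R}, |u x| ^ (p - 1) * H (u x) *
      ((Real.exp (-c * r x / p) - Real.exp (-c * R / p)) ^ p -
        Θ / (q - p + 1) ^ (p - 1) * Real.exp (-c * r x / p) ^ p) ∂μ ≤ 0 := by
  have hp0 : 0 < p := by linarith
  have hS : MeasurableSet {x | r x < R} := measurableSet_lt hr measurable_const
  -- The power factors are dominated by `|u|^q`, and the bracket is bounded uniformly in `n` because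
  -- `σ n ≥ σ₀`.
  refine le_of_tendsto' (tendsto_integral_of_dominated_convergence
    (fun x => |u x| ^ q * (1 + Θ / σ₀ ^ (p - 1))) (fun n => ?_) (hint.mul_const _) (fun n => ?_)
    ?_) henergy
  · refine AEMeasurable.aestronglyMeasurable (AEMeasurable.restrict ?_)
    refine ((hu.abs.pow_const _).mul
      ((hT.contDiff n).continuous.abs.measurable.comp_aemeasurable hu)).mul ?_
    refine AEMeasurable.sub ?_ (AEMeasurable.mul ?_ ?_)
    · exact (by fun_prop : Measurable fun x =>
        (Real.exp (-c * r x / p) - Real.exp (-c * R / p)) ^ p).aemeasurable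
    · exact aemeasurable_const.div
        (((hT.continuous_ratio n).measurable.comp_aemeasurable hu).pow_const _)
    · exact (by fun_prop : Measurable fun x => Real.exp (-c * r x / p) ^ p).aemeasurable
  · filter_upwards [ae_restrict_mem hS] with x hx
    have hx : r x < R := hx
    set w := Real.exp (-c * r x / p) with hw
    set ε := Real.exp (-c * R / p) with hε
    have hw1 : w ≤ 1 := by
      rw [hw, Real.exp_le_one_iff]
      exact div_nonpos_of_nonpos_of_nonneg (by nlinarith [hr0 x]) hp0.le
    have hεw : ε ≤ w := by
      rw [hw, hε, Real.exp_le_exp]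
      gcongr ?_ / p
      nlinarith
    have hε0 : 0 < ε := Real.exp_pos _
    have hw0 : 0 < w := Real.exp_pos _
    have hz1 : (w - ε) ^ p ≤ 1 :=
      Real.rpow_le_one (by linarith) (by linarith) hp0.le
    have hz0 : 0 ≤ (w - ε) ^ p := Real.rpow_nonneg (by linarith) _
    have hwp1 : w ^ p ≤ 1 := Real.rpow_le_one hw0.le hw1 hp0.le
    have hwp0 : 0 ≤ w ^ p := by positivity
    have hσ : σ₀ ≤ σ n (u x) := hT.le_ratio n _
    have hκ : Θ / σ n (u x) ^ (p - 1) ≤ Θ / σ₀ ^ (p - 1) := by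
      gcongr
    have hκ0 : 0 ≤ Θ / σ n (u x) ^ (p - 1) := by
      have := hσ₀.trans_le hσ; positivity
    rw [norm_mul, Real.norm_of_nonneg (by positivity : 0 ≤ |u x| ^ (p - 1) * |h n (u x)|)]
    refine mul_le_mul (hT.rpow_mul_abs_le hp hq n _) ?_ (norm_nonneg _) (by positivity)
    rw [Real.norm_eq_abs, abs_le]
    constructor
    · nlinarith [mul_le_mul hκ hwp1 hwp0 (hκ0.trans hκ)]
    · nlinarith [mul_nonneg hκ0 hwp0, hκ0.trans hκ]
  · refine Eventually.of_forall fun x => ?_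
    refine ((hT.tendsto_abs (u x)).const_mul _).mul (tendsto_const_nhds.sub (Tendsto.mul_const _ ?_))
    have hal : (0 : ℝ) < q - p + 1 := by linarith
    exact tendsto_const_nhds.div ((hT.tendsto_ratio (u x)).rpow_const (Or.inl hal.ne'))
      (Real.rpow_pos_of_pos hal _).ne'

/-- The weighted energy on a ball is controlled by the growth of `∫ |u|^q`. -/
theorem setIntegral_le_of_energy {p q c κ s C R R₀ : ℝ} (hp : 1 < p)
    (hc : 0 < c) (hκ : 0 ≤ κ) (hs0 : 0 < s) (hs1 : s < 1) (hR : R₀ + 1 ≤ R) {w : α → ℝ}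
    (hw : AEStronglyMeasurable w μ) (hw0 : ∀ x, 0 ≤ w x) (hwq : ∀ x, w x ≤ |u x| ^ q)
    (hr : Measurable r) (hr0 : ∀ x, 0 ≤ r x)
    (hint : IntegrableOn (fun x => |u x| ^ q) {x | r x < R} μ)
    (hgrowth : ∫ x in {x | r x < R}, |u x| ^ q ∂μ ≤ Real.exp (C * R))
    (henergy : ∫ x in {x | r x < R}, w x *
      ((Real.exp (-c * r x / p) - Real.exp (-c * R / p)) ^ p -
        κ * Real.exp (-c * r x / p) ^ p) ∂μ ≤ 0) (hθ : κ * (1 - s) ^ (1 - p) < 1) :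
    (1 - κ * (1 - s) ^ (1 - p)) *
        (Real.exp (-c * R₀ / p) - Real.exp (-c * (R₀ + 1) / p)) ^ p *
        ∫ x in {x | r x < R₀}, w x ∂μ ≤ κ * s ^ (1 - p) * Real.exp ((C - c) * R) := by
  have hp0 : 0 < p := by linarith
  have hS : MeasurableSet {x | r x < R} := measurableSet_lt hr measurable_const
  have hS₀ : MeasurableSet {x | r x < R₀} := measurableSet_lt hr measurable_const
  have hsub : {x | r x < R₀} ⊆ {x | r x < R} := fun x (hx : r x < R₀) =>
    show r x < R by linarith
  set θ := 1 - κ * (1 - s) ^ (1 - p) with hθdef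
  have hθ0 : 0 < θ := by linarith
  set z₀ := Real.exp (-c * R₀ / p) - Real.exp (-c * (R₀ + 1) / p) with hz₀def
  have hz₀ : 0 ≤ z₀ := by
    rw [hz₀def, sub_nonneg, Real.exp_le_exp]
    gcongr ?_ / p
    nlinarith
  have hwint : IntegrableOn w {x | r x < R} μ := by
    refine Integrable.mono' hint hw.restrict (Eventually.of_forall fun x => ?_)
    rw [Real.norm_of_nonneg (hw0 x)]; exact hwq x
  set ε := Real.exp (-c * R / p) with hε
  have hε0 : 0 < ε := Real.exp_pos _
  have hεp : ε ^ p = Real.exp (-c * R) := by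
    rw [hε, ← Real.exp_mul]; congr 1; field_simp
  have hwle : ∀ x, r x < R → ε ≤ Real.exp (-c * r x / p) ∧ Real.exp (-c * r x / p) ≤ 1 := by
    intro x hx
    constructor
    · rw [hε, Real.exp_le_exp]
      gcongr ?_ / p
      nlinarith
    · rw [Real.exp_le_one_iff]
      exact div_nonpos_of_nonpos_of_nonneg (by nlinarith [hr0 x]) hp0.le
  have hbdd : ∀ f : α → ℝ, Measurable f → (∀ x, r x < R → 0 ≤ f x ∧ f x ≤ 1) →
      IntegrableOn (fun x => w x * f x) {x | r x < R} μ := fun f hf hf1 => by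
    refine hwint.mul_bdd (c := 1) hf.aestronglyMeasurable.restrict ?_
    filter_upwards [ae_restrict_mem hS] with x hx
    rw [Real.norm_of_nonneg (hf1 x hx).1]; exact (hf1 x hx).2
  have i1 := hbdd (fun x => (Real.exp (-c * r x / p) - ε) ^ p) (by fun_prop) fun x hx =>
    ⟨Real.rpow_nonneg (by linarith [(hwle x hx).1]) _,
      Real.rpow_le_one (by linarith [(hwle x hx).1]) (by linarith [(hwle x hx).2]) hp0.le⟩
  have i2 := hbdd (fun x => Real.exp (-c * r x / p) ^ p) (by fun_prop) fun x hx =>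
    ⟨by positivity, Real.rpow_le_one (by positivity) (hwle x hx).2 hp0.le⟩
  -- Splitting `w^p = ((w - ε) + ε)^p` with weight `s` leaves the positive coefficient `θ` on `(w -
  -- ε)^p` and an error in `ε^p = e^{-cR}`.
  have step1 : ∫ x in {x | r x < R}, (θ * (w x * (Real.exp (-c * r x / p) - ε) ^ p) -
      κ * s ^ (1 - p) * ε ^ p * |u x| ^ q) ∂μ ≤ 0 := by
    refine le_trans (setIntegral_mono_on ((i1.const_mul _).sub (hint.const_mul _)) ?_ hS ?_) henergy
    · refine (i1.sub (i2.const_mul κ)).congr (Eventually.of_forall fun x => ?_)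
      simp only [Pi.sub_apply]; ring
    · intro x hx
      have hz : 0 ≤ Real.exp (-c * r x / p) - ε := by linarith [(hwle x hx).1]
      have h1 := add_rpow_le_weighted hp hs0 hs1 hz hε0.le
      rw [sub_add_cancel] at h1
      have hspos : 0 ≤ κ * s ^ (1 - p) * ε ^ p := by positivity
      calc θ * (w x * (Real.exp (-c * r x / p) - ε) ^ p) - κ * s ^ (1 - p) * ε ^ p * |u x| ^ q
          ≤ θ * (w x * (Real.exp (-c * r x / p) - ε) ^ p) - κ * s ^ (1 - p) * ε ^ p * w x := by
            gcongr; exact hwq x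
        _ = w x * ((Real.exp (-c * r x / p) - ε) ^ p - κ * ((1 - s) ^ (1 - p) *
            (Real.exp (-c * r x / p) - ε) ^ p + s ^ (1 - p) * ε ^ p)) := by rw [hθdef]; ring
        _ ≤ _ := by
          gcongr
          exact hw0 x
  rw [integral_sub (i1.const_mul _) (hint.const_mul _), integral_const_mul,
    integral_const_mul] at step1
  -- Since `R ≥ R₀ + 1`, the profile on the smaller ball is at least `z₀`, which does not depend on
  -- `R`.
  have step2 : z₀ ^ p * ∫ x in {x | r x < R₀}, w x ∂μ ≤
      ∫ x in {x | r x < R}, w x * (Real.exp (-c * r x / p) - ε) ^ p ∂μ := by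
    rw [← integral_const_mul]
    refine le_trans (setIntegral_mono_on ((hwint.mono_set hsub).const_mul _) (i1.mono_set hsub)
      hS₀ fun x hx => ?_) (setIntegral_mono_set i1 ?_ hsub.eventuallyLE)
    · rw [mul_comm]
      refine mul_le_mul_of_nonneg_left (Real.rpow_le_rpow hz₀ ?_ hp0.le) (hw0 x)
      have hx : r x < R₀ := hx
      refine sub_le_sub ?_ ?_ <;> rw [Real.exp_le_exp] <;> gcongr ?_ / p <;> nlinarith
    · filter_upwards [ae_restrict_mem hS] with x hx
      exact mul_nonneg (hw0 x) (Real.rpow_nonneg (by linarith [(hwle x hx).1]) _)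
  have hexp : Real.exp ((C - c) * R) = Real.exp (-c * R) * Real.exp (C * R) := by
    rw [← Real.exp_add]; congr 1; ring
  rw [hexp, ← hεp]
  calc θ * z₀ ^ p * ∫ x in {x | r x < R₀}, w x ∂μ
      = θ * (z₀ ^ p * ∫ x in {x | r x < R₀}, w x ∂μ) := by ring
    _ ≤ θ * ∫ x in {x | r x < R}, w x * (Real.exp (-c * r x / p) - ε) ^ p ∂μ := by gcongr
    _ ≤ κ * s ^ (1 - p) * ε ^ p * ∫ x in {x | r x < R}, |u x| ^ q ∂μ := by linarith
    _ ≤ κ * s ^ (1 - p) * ε ^ p * Real.exp (C * R) := by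
        have : 0 ≤ κ * s ^ (1 - p) * ε ^ p := by positivity
        gcongr
    _ = _ := by ring

/-- A function satisfying the truncated energy inequalities on all balls and growing too slowly
vanishes almost everywhere. -/
theorem ae_eq_zero_of_energy {p q c C Θ σ₀ : ℝ} (hp : 1 < p) (hq : p - 1 < q) (hc : 0 < c)
    (hC : C < c) (hΘ : 0 ≤ Θ) (hΘ1 : Θ < (q - p + 1) ^ (p - 1)) (hσ₀ : 0 < σ₀)
    {h σ : ℕ → ℝ → ℝ} {H : ℝ → ℝ} (hT : IsPowerTruncation (q - p + 1) σ₀ h σ H)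
    (hu : AEMeasurable u μ) (hr : Measurable r) (hr0 : ∀ x, 0 ≤ r x)
    (hint : ∀ R, IntegrableOn (fun x => |u x| ^ q) {x | r x < R} μ)
    (hgrowth : ∀ᶠ R in atTop, ∫ x in {x | r x < R}, |u x| ^ q ∂μ ≤ Real.exp (C * R))
    (henergy : ∀ R n, ∫ x in {x | r x < R}, |u x| ^ (p - 1) * |h n (u x)| *
      ((Real.exp (-c * r x / p) - Real.exp (-c * R / p)) ^ p -
        Θ / σ n (u x) ^ (p - 1) * Real.exp (-c * r x / p) ^ p) ∂μ ≤ 0) :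
    u =ᵐ[μ] 0 := by
  have hp0 : 0 < p := by linarith
  have hal : 0 < q - p + 1 := by linarith
  set κ := Θ / (q - p + 1) ^ (p - 1) with hκ
  have hκ0 : 0 ≤ κ := by positivity
  have hκ1 : κ < 1 := by rwa [hκ, div_lt_one (by positivity)]
  obtain ⟨s, hs0, hs1, hs⟩ := exists_absorption p hκ1
  set w : α → ℝ := fun x => |u x| ^ (p - 1) * H (u x) with hwdef
  have hwm : AEStronglyMeasurable w μ :=
    ((hu.abs.pow_const _).mul (hT.measurable_limit.comp_aemeasurable hu)).aestronglyMeasurable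
  have hw0 : ∀ x, 0 ≤ w x := fun x => mul_nonneg (by positivity) (hT.limit_nonneg _)
  have hwq : ∀ x, w x ≤ |u x| ^ q := fun x => hT.rpow_mul_limit_le hp hq _
  have hzero : ∀ R₀ : ℝ, ∀ᵐ x ∂μ, r x < R₀ → u x = 0 := fun R₀ => by
    have hS₀ : MeasurableSet {x | r x < R₀} := measurableSet_lt hr measurable_const
    have hwint : IntegrableOn w {x | r x < R₀} μ := by
      refine Integrable.mono' (hint R₀) hwm.restrict (Eventually.of_forall fun x => ?_)
      rw [Real.norm_of_nonneg (hw0 x)]; exact hwq x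
    set θ := (1 - κ * (1 - s) ^ (1 - p)) *
        (Real.exp (-c * R₀ / p) - Real.exp (-c * (R₀ + 1) / p)) ^ p with hθ
    have hθ0 : 0 < θ := by
      refine mul_pos (by linarith) (Real.rpow_pos_of_pos ?_ _)
      rw [sub_pos, Real.exp_lt_exp]
      gcongr ?_ / p
      nlinarith
    have hle : ∀ᶠ R in atTop, θ * ∫ x in {x | r x < R₀}, w x ∂μ ≤
        κ * s ^ (1 - p) * Real.exp ((C - c) * R) := by
      filter_upwards [hgrowth, eventually_ge_atTop (R₀ + 1)] with R hR hRR₀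
      exact setIntegral_le_of_energy hp hc hκ0 hs0 hs1 hRR₀ hwm hw0 hwq hr hr0 (hint R) hR
        (energy_limit_nonpos hp hq hc hΘ hσ₀ hT hu hr hr0 (hint R) (henergy R)) hs
    -- Here `C < c` is used: the bound decays while the left side does not depend on `R`.
    have hlim : Tendsto (fun R : ℝ => κ * s ^ (1 - p) * Real.exp ((C - c) * R)) atTop (𝓝 0) := by
      have h1 : Tendsto (fun R : ℝ => (C - c) * R) atTop atBot :=
        tendsto_id.const_mul_atTop_of_neg (by linarith)
      simpa using (Real.tendsto_exp_atBot.comp h1).const_mul (κ * s ^ (1 - p))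
    have h0 : θ * ∫ x in {x | r x < R₀}, w x ∂μ ≤ 0 := ge_of_tendsto hlim hle
    have h1 : ∫ x in {x | r x < R₀}, w x ∂μ = 0 :=
      le_antisymm (by nlinarith) (integral_nonneg hw0)
    rw [integral_eq_zero_iff_of_nonneg hw0 hwint] at h1
    filter_upwards [(ae_restrict_iff' hS₀).1 h1] with x hx hxr
    by_contra hne
    have h2 : w x = 0 := hx hxr
    have h3 : 0 < w x := mul_pos (Real.rpow_pos_of_pos (abs_pos.2 hne) _) (hT.limit_pos _ hne)
    linarith
  have hall : ∀ᵐ x ∂μ, ∀ n : ℕ, r x < n → u x = 0 := ae_all_iff.2 fun n => hzero n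
  filter_upwards [hall] with x hx
  obtain ⟨n, hn⟩ := exists_nat_gt (r x)
  exact hx n hn

end Energy

/-! ### Testing the equation. -/

theorem rpow_mul_le_add_rpow {p a b : ℝ} (hp : 1 < p) (ha : 0 ≤ a) (hb : 0 ≤ b) :
    a ^ (p - 1) * b ≤ a ^ p + b ^ p := by
  have hsplit : ∀ t : ℝ, 0 ≤ t → t ^ p = t ^ (p - 1) * t := fun t ht => by
    rw [← Real.rpow_add_one' ht (by linarith), sub_add_cancel]
  rcases le_total b a with h | h
  · calc a ^ (p - 1) * b ≤ a ^ (p - 1) * a := by gcongr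
      _ = a ^ p := (hsplit a ha).symm
      _ ≤ _ := le_add_of_nonneg_right (by positivity)
  · calc a ^ (p - 1) * b ≤ b ^ (p - 1) * b := by
          gcongr
      _ = b ^ p := (hsplit b hb).symm
      _ ≤ _ := le_add_of_nonneg_left (by positivity)

/-- Insert `a ≤ z x` in the coercivity bound, raise to the power `p` and divide by `z^{p-1}`. Thus
weak coercivity implies the growth `|A| ≤ k^p |ξ|^{p-1}`. -/
theorem le_rpow_mul_rpow_of_coercive {p k z x a : ℝ} (hp : 1 < p) (hk : 0 < k) (hz : 0 ≤ z)
    (hx : 0 ≤ x) (ha : 0 ≤ a) (hza : z ≤ k * a ^ ((p - 1) / p)) (hax : a ≤ z * x) :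
    z ≤ k ^ p * x ^ (p - 1) := by
  have hp0 : 0 < p := by linarith
  have hp1 : 0 < p - 1 := by linarith
  rcases hz.eq_or_lt with rfl | hz
  · positivity
  have h1 : z ≤ k * (z * x) ^ ((p - 1) / p) := hza.trans (by gcongr)
  have h2 : z ^ p ≤ k ^ p * (z ^ (p - 1) * x ^ (p - 1)) := by
    have := Real.rpow_le_rpow hz.le h1 hp0.le
    rwa [Real.mul_rpow hk.le (by positivity), ← Real.rpow_mul (by positivity),
      div_mul_cancel₀ _ hp0.ne', Real.mul_rpow hz.le hx] at this
  have h3 : z ^ p = z ^ (p - 1) * z := by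
    rw [← Real.rpow_add_one hz.ne', sub_add_cancel]
  rw [h3] at h2
  have h4 : 0 < z ^ (p - 1) := by positivity
  refine le_of_mul_le_mul_left ?_ h4
  linarith

theorem abs_rpow_sub_two_mul_mul {p t s : ℝ} (hp : 1 < p) (hts : 0 ≤ t * s) :
    |t| ^ (p - 2) * t * s = |t| ^ (p - 1) * |s| := by
  rcases eq_or_ne t 0 with rfl | ht
  · simp [Real.zero_rpow (by linarith : p - 1 ≠ 0)]
  have ht' : 0 < |t| := abs_pos.2 ht
  have h1 : |t| ^ (p - 1) = |t| ^ (p - 2) * |t| := by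
    rw [← Real.rpow_add_one ht'.ne']; congr 1; ring
  rw [h1, mul_assoc, mul_assoc, ← abs_mul, abs_of_nonneg hts]

section

variable {m : ℕ} {M : Type*} [MetricSpace M] [SecondCountableTopology M]
  [MeasurableSpace M] [BorelSpace M]
  [ChartedSpace (EuclideanSpace ℝ (Fin m)) M] [IsManifold (𝓡 m) ∞ M]
  [RiemannianBundle (fun x : M => TangentSpace (𝓡 m) x)]
  [IsContMDiffRiemannianBundle (𝓡 m) ∞ (EuclideanSpace ℝ (Fin m))
    (fun x : M => TangentSpace (𝓡 m) x)]
  [IsRiemannianManifold (𝓡 m) M]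

/-- The weak gradient of `h(u) G(r)`. -/
def testGradient (u : M → ℝ) (X : (x : M) → TangentSpace (𝓡 m) x) (h : ℝ → ℝ) (r : M → ℝ)
    (G : ℝ → ℝ) (x : M) : TangentSpace (𝓡 m) x :=
  (deriv h (u x) * G (r x)) • X x + (h (u x) * deriv G (r x)) • grad m r x

/-- The condition `h 0 = 0` gives `|h(u)| ≤ L |u|`, so local `L^p` bounds carry over without local
finiteness of the volume. -/
theorem HasSobolevGradient.comp_mul_comp {p : ℝ} {u : M → ℝ}
    {X : (x : M) → TangentSpace (𝓡 m) x}
    (hu : HasSobolevGradient p u X) {h : ℝ → ℝ} (hh : ContDiff ℝ 1 h) (h0 : h 0 = 0) {L : ℝ≥0}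
    (hL : ∀ t, ‖deriv h t‖ ≤ L) {r : M → ℝ} (hr : LipschitzWith 1 r)
    {G : ℝ → ℝ} (hG : ContDiff ℝ 1 G) :
    HasSobolevGradient p (fun x => h (u x) * G (r x)) (testGradient u X h r G) := by
  have hhL : LipschitzWith L h := lipschitzWith_of_nnnorm_deriv_le
    (hh.differentiable one_ne_zero) hL
  have hhu : ∀ t, |h t| ≤ L * |t| := fun t => by
    simpa [Real.dist_eq, h0] using hhL.dist_le_mul t 0
  have hgrad := hu.isWeakGradient.comp_mul_comp hh hL hr hG
  refine ⟨hgrad, fun K hK => ?_, fun K hK => ?_⟩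
  · obtain ⟨B, hB⟩ := hK.exists_bound_of_continuousOn
      (hG.continuous.comp hr.continuous).continuousOn
    have hum := hu.memLp K hK
    refine MemLp.of_le_mul (c := L * B) hum ?_ ?_
    · exact (hh.continuous.comp_aestronglyMeasurable hum.aestronglyMeasurable).mul
        (hG.continuous.comp hr.continuous).aestronglyMeasurable
    · filter_upwards [ae_restrict_mem hK.measurableSet] with x hx
      rw [norm_mul]
      calc ‖h (u x)‖ * ‖G (r x)‖ ≤ (L * |u x|) * B := by
            gcongr
            · exact hhu _
            · exact hB x hx
        _ = L * B * ‖u x‖ := by rw [Real.norm_eq_abs]; ring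
  · obtain ⟨B, hB⟩ := hK.exists_bound_of_continuousOn
      (hG.continuous.comp hr.continuous).continuousOn
    obtain ⟨B', hB'⟩ := hK.exists_bound_of_continuousOn
      ((hG.continuous_deriv le_rfl).comp hr.continuous).continuousOn
    have hdom := ((hu.memLp_grad K hK).const_mul (L * B)).add
      ((hu.memLp K hK).norm.const_mul (L * B'))
    refine hdom.mono' ?_ ?_
    · exact hgrad.isChartMeasurable.aemeasurable_norm.aestronglyMeasurable.restrict
    · filter_upwards [ae_restrict_mem hK.measurableSet] with x hx
      rw [norm_norm]
      refine (norm_add_le _ _).trans ?_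
      rw [norm_smul, norm_smul, norm_mul, norm_mul]
      simp only [Pi.add_apply]
      have h1 : ‖deriv h (u x)‖ * ‖G (r x)‖ * ‖X x‖ ≤ L * B * ‖X x‖ := by
        gcongr
        · exact hL _
        · exact hB x hx
      have h2 : ‖h (u x)‖ * ‖deriv G (r x)‖ * ‖grad m r x‖ ≤ L * B' * ‖u x‖ := by
        calc ‖h (u x)‖ * ‖deriv G (r x)‖ * ‖grad m r x‖ ≤ (L * |u x|) * B' * 1 := by
              gcongr
              · exact mul_nonneg (by positivity) ((norm_nonneg _).trans (hB' x hx))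
              · exact hhu _
              · exact hB' x hx
              · exact norm_grad_le_one hr x
          _ = L * B' * ‖u x‖ := by rw [Real.norm_eq_abs]; ring
      exact add_le_add h1 h2

end

section

variable {m : ℕ} {M : Type*} [MetricSpace M]
  [ChartedSpace (EuclideanSpace ℝ (Fin m)) M] [IsManifold (𝓡 m) ∞ M]
  [RiemannianBundle (fun x : M => TangentSpace (𝓡 m) x)]
  [IsContMDiffRiemannianBundle (𝓡 m) ∞ (EuclideanSpace ℝ (Fin m))
    (fun x : M => TangentSpace (𝓡 m) x)]
  [IsRiemannianManifold (𝓡 m) M]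

/-- Cauchy–Schwarz with `|∇r| ≤ 1` and coercivity bound the term containing the derivative of the
cut-off; `young_pointwise` with `b = k c` absorbs it. -/
theorem integrand_lower_bound {p lam k c R σ : ℝ} (hp : 1 < p) (hlam : 0 < lam) (hk : 0 < k)
    (hc : 0 < c) (hσ : 0 < σ)
    {A : (x : M) → ℝ → TangentSpace (𝓡 m) x → TangentSpace (𝓡 m) x}
    (hA : IsWeaklyCoercive p k A) (u : M → ℝ) (X : (x : M) → TangentSpace (𝓡 m) x)
    {r : M → ℝ} (hr : LipschitzWith 1 r) {h : ℝ → ℝ} {x : M} (hx : r x < R)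
    (hmul : 0 ≤ u x * h (u x)) (hderiv : 0 ≤ deriv h (u x))
    (hratio : σ * |h (u x)| ≤ |u x| * deriv h (u x)) :
    lam * (|u x| ^ (p - 1) * |h (u x)| *
      ((Real.exp (-c * r x / p) - Real.exp (-c * R / p)) ^ p -
        (k * c) ^ p / (p * lam * (p / (p - 1)) ^ (p - 1)) / σ ^ (p - 1) *
          Real.exp (-c * r x / p) ^ p)) ≤
      ⟪A x (u x) (X x), testGradient u X h r (cutoff p c R) x⟫_ℝ +
        lam * (|u x| ^ (p - 2) * u x) * (h (u x) * cutoff p c R (r x)) := by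
  have hp0 : 0 < p := by linarith
  set w := Real.exp (-c * r x / p) with hw
  set ε := Real.exp (-c * R / p) with hε
  have hεw : ε ≤ w := by
    rw [hw, hε, Real.exp_le_exp]
    gcongr ?_ / p
    nlinarith
  have hz : 0 ≤ w - ε := by linarith
  have hw0 : 0 ≤ w := (Real.exp_pos _).le
  have hG : cutoff p c R (r x) = (w - ε) ^ p := by
    rw [cutoff, ← hw, ← hε, max_eq_left hz]
  have hG' : deriv (cutoff p c R) (r x) = -c * w * (w - ε) ^ (p - 1) := by
    rw [(hasDerivAt_cutoff hp c R (r x)).deriv, ← hw, ← hε, max_eq_left hz]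
  set a := ⟪A x (u x) (X x), X x⟫_ℝ with ha
  have ha0 : 0 ≤ a := hA.inner_nonneg _ _ _
  have hyoung := young_pointwise (b := k * c) hp hlam (by positivity) hσ ha0 hz hw0
    (abs_nonneg (u x)) (abs_nonneg (h (u x))) hderiv hratio
  have hinner : ⟪A x (u x) (X x), testGradient u X h r (cutoff p c R) x⟫_ℝ =
      deriv h (u x) * (w - ε) ^ p * a +
        h (u x) * (-c * w * (w - ε) ^ (p - 1)) * ⟪A x (u x) (X x), grad m r x⟫_ℝ := by
    rw [testGradient, inner_add_right, real_inner_smul_right, real_inner_smul_right, hG, hG']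
  have hzp : 0 ≤ (w - ε) ^ (p - 1) := Real.rpow_nonneg hz _
  have hbound : |h (u x) * (-c * w * (w - ε) ^ (p - 1)) * ⟪A x (u x) (X x), grad m r x⟫_ℝ| ≤
      k * c * a ^ ((p - 1) / p) * |h (u x)| * (w * (w - ε) ^ (p - 1)) := by
    have h1 : |⟪A x (u x) (X x), grad m r x⟫_ℝ| ≤ k * a ^ ((p - 1) / p) :=
      calc |⟪A x (u x) (X x), grad m r x⟫_ℝ| ≤ ‖A x (u x) (X x)‖ * ‖grad m r x‖ :=
            abs_real_inner_le_norm _ _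
        _ ≤ ‖A x (u x) (X x)‖ * 1 := by gcongr; exact norm_grad_le_one hr x
        _ ≤ k * a ^ ((p - 1) / p) := by rw [mul_one]; exact hA.norm_le _ _ _
    have h2 : |-c * w * (w - ε) ^ (p - 1)| = c * w * (w - ε) ^ (p - 1) := by
      rw [abs_mul, abs_mul, abs_neg, abs_of_pos hc, abs_of_nonneg hw0, abs_of_nonneg hzp]
    rw [abs_mul, abs_mul, h2]
    calc |h (u x)| * (c * w * (w - ε) ^ (p - 1)) * |⟪A x (u x) (X x), grad m r x⟫_ℝ|
        ≤ |h (u x)| * (c * w * (w - ε) ^ (p - 1)) * (k * a ^ ((p - 1) / p)) := by gcongr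
      _ = _ := by ring
  have hlow := (abs_le.1 hbound).1
  have hf : lam * (|u x| ^ (p - 2) * u x) * (h (u x) * cutoff p c R (r x)) =
      lam * (|u x| ^ (p - 1) * |h (u x)|) * (w - ε) ^ p := by
    rw [hG, ← abs_rpow_sub_two_mul_mul hp hmul]; ring
  rw [hinner, hf]
  generalize (k * c) ^ p / (p * lam * (p / (p - 1)) ^ (p - 1)) / σ ^ (p - 1) = κ at hyoung ⊢
  nlinarith

end

section

variable {m : ℕ} {M : Type*} [MetricSpace M] [SecondCountableTopology M]
  [MeasurableSpace M] [BorelSpace M]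
  [ChartedSpace (EuclideanSpace ℝ (Fin m)) M] [IsManifold (𝓡 m) ∞ M]
  [RiemannianBundle (fun x : M => TangentSpace (𝓡 m) x)]

theorem IsWeakGradient.aemeasurable {u : M → ℝ} {X : (x : M) → TangentSpace (𝓡 m) x}
    (hu : IsWeakGradient u X) : AEMeasurable u (riemannianVolume m M) :=
  aemeasurable_riemannianVolume fun e he =>
    (hu.locallyIntegrable e he).aestronglyMeasurable.aemeasurable

variable [IsContMDiffRiemannianBundle (𝓡 m) ∞ (EuclideanSpace ℝ (Fin m))
    (fun x : M => TangentSpace (𝓡 m) x)]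

/-- The growth `|A| ≤ k^p |X|^{p-1}` pairs with `Y`, since `X` and `Y` are both in `L^p` on `K`. -/
theorem IsWeaklyCoercive.integrable_inner {p k : ℝ} (hp : 1 < p) (hk : 0 < k)
    {A : (x : M) → ℝ → TangentSpace (𝓡 m) x → TangentSpace (𝓡 m) x}
    (hA : IsWeaklyCoercive p k A) {u φ : M → ℝ} {X Y : (x : M) → TangentSpace (𝓡 m) x}
    (hu : HasSobolevGradient p u X) (hφ : HasSobolevGradient p φ Y) {K : Set M}
    (hK : IsCompact K) (hY : ∀ x ∉ K, Y x = 0) :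
    Integrable (fun x => ⟪A x (u x) (X x), Y x⟫_ℝ) (riemannianVolume m M) := by
  have hZ : IsChartMeasurable fun x => A x (u x) (X x) :=
    hA.caratheodory.isChartMeasurable (fun e he =>
      (hu.isWeakGradient.locallyIntegrable e he).aestronglyMeasurable.aemeasurable)
      hu.isWeakGradient.isChartMeasurable
  have hm := (hZ.aemeasurable_inner hφ.isWeakGradient.isChartMeasurable).aestronglyMeasurable
  have hp0 : 0 < p := by linarith
  have hsupp : Function.support (fun x => ⟪A x (u x) (X x), Y x⟫_ℝ) ⊆ K := fun x hx => by
    by_contra hxK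
    exact hx (by simp [hY x hxK])
  rw [← integrableOn_iff_integrable_of_support_subset hsupp]
  have hpne : ENNReal.ofReal p ≠ 0 := by simpa using hp0
  have i1 := (hu.memLp_grad K hK).integrable_norm_rpow hpne ENNReal.ofReal_ne_top
  have i2 := (hφ.memLp_grad K hK).integrable_norm_rpow hpne ENNReal.ofReal_ne_top
  rw [ENNReal.toReal_ofReal hp0.le] at i1 i2
  simp only [norm_norm] at i1 i2
  refine Integrable.mono' ((i1.add i2).const_mul (k ^ p)) hm.restrict
    (Eventually.of_forall fun x => ?_)
  have hz : ‖A x (u x) (X x)‖ ≤ k ^ p * ‖X x‖ ^ (p - 1) :=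
    le_rpow_mul_rpow_of_coercive hp hk (norm_nonneg _) (norm_nonneg _) (hA.inner_nonneg _ _ _)
      (hA.norm_le _ _ _) (real_inner_le_norm _ _)
  calc ‖⟪A x (u x) (X x), Y x⟫_ℝ‖ ≤ ‖A x (u x) (X x)‖ * ‖Y x‖ := norm_inner_le_norm _ _
    _ ≤ k ^ p * ‖X x‖ ^ (p - 1) * ‖Y x‖ := by gcongr
    _ = k ^ p * (‖X x‖ ^ (p - 1) * ‖Y x‖) := by ring
    _ ≤ k ^ p * (‖X x‖ ^ p + ‖Y x‖ ^ p) := by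
      gcongr
      exact rpow_mul_le_add_rpow hp (norm_nonneg _) (norm_nonneg _)

variable [IsRiemannianManifold (𝓡 m) M]

/-- The energy inequality obtained by testing the equation with `h(u) (e^{-cr/p} - e^{-cR/p})₊^p`. -/
theorem energy_nonpos [ProperSpace M] {p lam k c R : ℝ} (hp : 1 < p) (hlam : 0 < lam) (hk : 0 < k)
    (hc : 0 < c) {A : (x : M) → ℝ → TangentSpace (𝓡 m) x → TangentSpace (𝓡 m) x}
    (hA : IsWeaklyCoercive p k A) {u : M → ℝ}
    {X : (x : M) → TangentSpace (𝓡 m) x} (hu : HasSobolevGradient p u X)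
    (hsol : ∀ (φ : M → ℝ) (Y : (x : M) → TangentSpace (𝓡 m) x),
      HasSobolevGradient p φ Y → HasCompactSupport φ →
        -∫ x, ⟪A x (u x) (X x), Y x⟫_ℝ ∂(riemannianVolume m M) =
          ∫ x, lam * (|u x| ^ (p - 2) * u x) * φ x ∂(riemannianVolume m M))
    (x₀ : M) {h σ : ℝ → ℝ} {σ₀ : ℝ} (hh : ContDiff ℝ 1 h) {L : ℝ≥0}
    (hL : ∀ t, ‖deriv h t‖ ≤ L) (hmul : ∀ t, 0 ≤ t * h t) (hderiv : ∀ t, 0 ≤ deriv h t)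
    (hσ₀ : 0 < σ₀) (hσc : Continuous σ) (hσ : ∀ t, σ₀ ≤ σ t)
    (hratio : ∀ t, σ t * |h t| ≤ |t| * deriv h t)
    (hint : IntegrableOn (fun x => |u x| ^ (p - 1) * |h (u x)|) {x | dist x x₀ < R}
      (riemannianVolume m M)) (h0 : h 0 = 0) :
    ∫ x in {x | dist x x₀ < R}, |u x| ^ (p - 1) * |h (u x)| *
      ((Real.exp (-c * dist x x₀ / p) - Real.exp (-c * R / p)) ^ p -
        (k * c) ^ p / (p * lam * (p / (p - 1)) ^ (p - 1)) / σ (u x) ^ (p - 1) *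
          Real.exp (-c * dist x x₀ / p) ^ p) ∂(riemannianVolume m M) ≤ 0 := by
  have hp0 : 0 < p := by linarith
  set μ := riemannianVolume m M with hμ
  set r : M → ℝ := fun x => dist x x₀ with hrdef
  have hr : LipschitzWith 1 r := LipschitzWith.dist_left x₀
  have hS : MeasurableSet {x | r x < R} :=
    measurableSet_lt hr.continuous.measurable measurable_const
  set G := cutoff p c R with hGdef
  set Θ := (k * c) ^ p / (p * lam * (p / (p - 1)) ^ (p - 1)) with hΘ
  have hG0 : ∀ x, ¬ r x < R → G (r x) = 0 := fun x hx => cutoff_eq_zero hp hc (not_lt.1 hx)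
  have hG0' : ∀ x, ¬ r x < R → deriv G (r x) = 0 := fun x hx => by
    have hle : Real.exp (-c * r x / p) - Real.exp (-c * R / p) ≤ 0 := by
      rw [sub_nonpos, Real.exp_le_exp]
      gcongr ?_ / p
      nlinarith [not_lt.1 hx]
    rw [hGdef, (hasDerivAt_cutoff hp c R (r x)).deriv, max_eq_right hle,
      Real.zero_rpow (by linarith), mul_zero]
  have hφ := hu.comp_mul_comp hh h0 hL hr (contDiff_cutoff hp c R)
  set Y := testGradient u X h r G with hY
  have hY0 : ∀ x, ¬ r x < R → Y x = 0 := fun x hx => by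
    simp only [hY, testGradient, hG0 x hx, hG0' x hx, mul_zero, zero_smul, add_zero]
  have hK : IsCompact (Metric.closedBall x₀ R) := isCompact_closedBall x₀ R
  have hsub : {x | r x < R} ⊆ Metric.closedBall x₀ R := fun x (hx : r x < R) => hx.le
  have hcs : HasCompactSupport fun x => h (u x) * G (r x) :=
    HasCompactSupport.intro hK fun x hx => by
      rw [hG0 x fun hlt => hx (hsub hlt), mul_zero]
  have heq := hsol _ Y hφ hcs
  have i1 : Integrable (fun x => ⟪A x (u x) (X x), Y x⟫_ℝ) μ :=
    hA.integrable_inner hp hk hu hφ hK fun x hx => hY0 x fun hlt => hx (hsub hlt)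
  have hGm : Measurable fun x => G (r x) :=
    ((contDiff_cutoff hp c R).continuous.comp hr.continuous).measurable
  have hw1 : ∀ x, Real.exp (-c * r x / p) ≤ 1 := fun x => by
    rw [Real.exp_le_one_iff]
    exact div_nonpos_of_nonpos_of_nonneg (by nlinarith [dist_nonneg (x := x) (y := x₀)]) hp0.le
  have hwε : ∀ x, r x < R → Real.exp (-c * R / p) ≤ Real.exp (-c * r x / p) := fun x hx => by
    rw [Real.exp_le_exp]
    gcongr ?_ / p
    nlinarith
  have hzb : ∀ x, r x < R → 0 ≤ (Real.exp (-c * r x / p) - Real.exp (-c * R / p)) ^ p ∧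
      (Real.exp (-c * r x / p) - Real.exp (-c * R / p)) ^ p ≤ 1 := fun x hx =>
    ⟨Real.rpow_nonneg (by linarith [hwε x hx]) _, Real.rpow_le_one (by linarith [hwε x hx])
      (by linarith [hw1 x, Real.exp_pos (-c * R / p)]) hp0.le⟩
  have i2 : IntegrableOn (fun x => lam * (|u x| ^ (p - 2) * u x) * (h (u x) * G (r x)))
      {x | r x < R} μ := by
    have hb : IntegrableOn (fun x => |u x| ^ (p - 1) * |h (u x)| * G (r x)) {x | r x < R} μ := by
      refine hint.mul_bdd (c := 1) hGm.aestronglyMeasurable.restrict ?_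
      filter_upwards [ae_restrict_mem hS] with x hx
      have hGx : G (r x) = (Real.exp (-c * r x / p) - Real.exp (-c * R / p)) ^ p := by
        rw [hGdef, cutoff, max_eq_left (by linarith [hwε x hx])]
      rw [hGx, Real.norm_of_nonneg (hzb x hx).1]
      exact (hzb x hx).2
    refine Integrable.congr (hb.const_mul lam) (Eventually.of_forall fun x => ?_)
    simp only
    rw [← abs_rpow_sub_two_mul_mul hp (hmul (u x))]
    ring
  -- This is the weak equation: the test function and its gradient vanish off the ball, so the
  -- integrals over `M` reduce to it.
  have hlhs : ∫ x in {x | r x < R}, (⟪A x (u x) (X x), Y x⟫_ℝ +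
      lam * (|u x| ^ (p - 2) * u x) * (h (u x) * G (r x))) ∂μ = 0 := by
    rw [integral_add i1.integrableOn i2,
      setIntegral_eq_integral_of_forall_compl_eq_zero (fun x hx => by
        rw [hY0 x hx, inner_zero_right]),
      setIntegral_eq_integral_of_forall_compl_eq_zero (fun x hx => by
        rw [hG0 x hx, mul_zero, mul_zero]), ← heq]
    ring
  have hum : AEMeasurable u μ := hu.isWeakGradient.aemeasurable
  have i3 : IntegrableOn (fun x => |u x| ^ (p - 1) * |h (u x)| *
      ((Real.exp (-c * r x / p) - Real.exp (-c * R / p)) ^ p -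
        Θ / σ (u x) ^ (p - 1) * Real.exp (-c * r x / p) ^ p)) {x | r x < R} μ := by
    have hrm : Measurable r := hr.continuous.measurable
    refine hint.mul_bdd (c := 1 + Θ / σ₀ ^ (p - 1)) ?_ ?_
    · refine (AEMeasurable.sub ?_ (AEMeasurable.mul ?_ ?_)).aestronglyMeasurable.restrict
      · exact (by fun_prop : Measurable fun x =>
          (Real.exp (-c * r x / p) - Real.exp (-c * R / p)) ^ p).aemeasurable
      · exact aemeasurable_const.div ((hσc.measurable.comp_aemeasurable hum).pow_const _)
      · exact (by fun_prop : Measurable fun x => Real.exp (-c * r x / p) ^ p).aemeasurable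
    · filter_upwards [ae_restrict_mem hS] with x hx
      obtain ⟨hz0, hz1⟩ := hzb x hx
      have hΘ0 : 0 ≤ Θ := by
        have : 0 < p - 1 := by linarith
        positivity
      have hκ : Θ / σ (u x) ^ (p - 1) ≤ Θ / σ₀ ^ (p - 1) := by
        gcongr
        exact hσ _
      have hκ0 : 0 ≤ Θ / σ (u x) ^ (p - 1) := by
        have := hσ₀.trans_le (hσ (u x)); positivity
      have hwp1 : Real.exp (-c * r x / p) ^ p ≤ 1 :=
        Real.rpow_le_one (Real.exp_pos _).le (hw1 x) hp0.le
      have hwp0 : 0 ≤ Real.exp (-c * r x / p) ^ p := by positivity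
      rw [Real.norm_eq_abs, abs_le]
      constructor
      · nlinarith [mul_le_mul hκ hwp1 hwp0 (hκ0.trans hκ)]
      · nlinarith [mul_nonneg hκ0 hwp0, hκ0.trans hκ]
  have hfinal := setIntegral_mono_on (i3.const_mul lam) (i1.integrableOn.add i2) hS fun x hx =>
    integrand_lower_bound hp hlam hk hc (hσ₀.trans_le (hσ (u x))) hA u X hr hx (hmul _) (hderiv _)
      (hratio _)
  have hfinal' : lam * ∫ x in {x | r x < R}, |u x| ^ (p - 1) * |h (u x)| *
      ((Real.exp (-c * r x / p) - Real.exp (-c * R / p)) ^ p -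
        Θ / σ (u x) ^ (p - 1) * Real.exp (-c * r x / p) ^ p) ∂μ ≤ 0 := by
    rw [← integral_const_mul]
    exact hfinal.trans_eq hlhs
  exact nonpos_of_mul_nonpos_right hfinal' hlam

end

end RiemannianLiouville

end

/-! ### Conclusion. -/

theorem mainTheorem3 {m : ℕ} {M : Type*} [MetricSpace M] [SecondCountableTopology M]
    [ConnectedSpace M] [MeasurableSpace M] [BorelSpace M]
    [ChartedSpace (EuclideanSpace ℝ (Fin m)) M] [IsManifold (𝓡 m) ∞ M]
    [RiemannianBundle (fun x : M => TangentSpace (𝓡 m) x)]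
    [IsContMDiffRiemannianBundle (𝓡 m) ∞ (EuclideanSpace ℝ (Fin m))
      (fun x : M => TangentSpace (𝓡 m) x)]
    [IsRiemannianManifold (𝓡 m) M] [CompleteSpace M]
    (p lam k : ℝ) (hp : 1 < p) (hlam : 0 < lam) (hk : 0 < k)
    (A : (x : M) → ℝ → TangentSpace (𝓡 m) x → TangentSpace (𝓡 m) x)
    (hA : RiemannianLiouville.IsWeaklyCoercive p k A)
    (u : M → ℝ) (hu : RiemannianLiouville.MemSobolevLoc m p u)
    (hsol : RiemannianLiouville.IsWeakSolution p A (fun x => lam * (|u x| ^ (p - 2) * u x)) u)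
    (x₀ : M) (q C : ℝ) (hq : p - 1 < q)
    (hC : C < p * (q - p + 1) ^ (1 / Real.conjExponent p) / (p - 1) ^ (1 / Real.conjExponent p) *
      (lam ^ (1 / p) / k))
    (hgrowth : ∀ᶠ R : ℝ in atTop,
      ∫⁻ x in Metric.ball x₀ R, ENNReal.ofReal (|u x| ^ q)
        ∂(RiemannianLiouville.riemannianVolume m M) ≤ ENNReal.ofReal (Real.exp (C * R))) :
    u =ᵐ[RiemannianLiouville.riemannianVolume m M] 0 := by
  have : ProperSpace M := RiemannianLiouville.properSpace_of_completeSpace m M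
  obtain ⟨X, hX, htest⟩ := hsol
  have hp1 : 0 < p - 1 := by linarith
  have hal : 0 < q - p + 1 := by linarith
  -- `c > C` makes the error decay, `c > 0` makes the cut-off profile decreasing, and `c` below the
  -- critical constant gives `κ < 1`.
  obtain ⟨c, hc, hcC⟩ := exists_between (show max C 0 < p * (q - p + 1) ^
      (1 / Real.conjExponent p) / (p - 1) ^ (1 / Real.conjExponent p) * (lam ^ (1 / p) / k) from
    max_lt hC (by positivity))
  have hc0 : 0 < c := (le_max_right _ _).trans_lt hc
  obtain ⟨σ₀, hσ₀, h, σ, H, hT⟩ := RiemannianLiouville.exists_isPowerTruncation hal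
  have hum : AEMeasurable u (RiemannianLiouville.riemannianVolume m M) :=
    hX.isWeakGradient.aemeasurable
  -- The growth bound at some radius `R' ≥ R` already gives finiteness on the ball of radius `R`.
  have hint : ∀ R, IntegrableOn (fun x => |u x| ^ q) {x | dist x x₀ < R}
      (RiemannianLiouville.riemannianVolume m M) := fun R => by
    obtain ⟨R', hR', hRR'⟩ := (hgrowth.and (eventually_ge_atTop R)).exists
    refine IntegrableOn.mono_set (t := Metric.ball x₀ R') ?_ (Metric.ball_subset_ball hRR')
    refine ⟨(hum.abs.pow_const q).aestronglyMeasurable.restrict, ?_⟩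
    rw [hasFiniteIntegral_iff_ofReal (Eventually.of_forall fun x => by positivity)]
    exact hR'.trans_lt ENNReal.ofReal_lt_top
  refine RiemannianLiouville.ae_eq_zero_of_energy (C := C) hp hq hc0
    ((le_max_left _ _).trans_lt hc) (by positivity)
    (RiemannianLiouville.coercivity_ratio_lt hp hlam hk hc0 hal hcC) hσ₀ hT hum
    (r := fun x => dist x x₀) (by fun_prop) (fun x => dist_nonneg) hint ?_ fun R n => ?_
  · filter_upwards [hgrowth] with R hR
    rw [integral_eq_lintegral_of_nonneg_ae (Eventually.of_forall fun x => by positivity)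
      (hint R).aestronglyMeasurable]
    exact ENNReal.toReal_le_of_le_ofReal (Real.exp_pos _).le hR
  · obtain ⟨L, hL⟩ := hT.exists_bound n
    have hle := fun t => hT.rpow_mul_abs_le hp hq n t
    refine RiemannianLiouville.energy_nonpos hp hlam hk hc0 hA hX htest x₀ (hT.contDiff n) hL
      (hT.mul_nonneg n) (hT.deriv_nonneg n) hσ₀ (hT.continuous_ratio n) (hT.le_ratio n)
      (hT.ratio_mul_le n) ?_ ?_
    · refine Integrable.mono' (hint R) ?_ (Eventually.of_forall fun x => ?_)
      · exact ((hum.abs.pow_const _).mul ((hT.contDiff n).continuous.abs.measurable.comp_aemeasurable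
          hum)).aestronglyMeasurable.restrict
      · rw [Real.norm_of_nonneg (by positivity)]
        exact hle (u x)
    · have h0 := hT.abs_le n 0
      rw [abs_zero, Real.zero_rpow hal.ne'] at h0
      exact abs_nonpos_iff.1 h0
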